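/- **Setting.** Let $d,r$ be integers with $r\le \frac d2-1$, put $n=d-1$, and label vectors and tensors of dimension $d$ by $0,1,\dots,n$. Let $\Omega$ be the set of triples of pairwise distinct labels, and let $\|\cdot\|$ be the Euclidean / Frobenius / Hilbert–Schmidt norm. Consider a $d$-dimensional Gaussian mixture with weights $\omega_i>0$, $\sum_{i=1}^r\omega_i=1$, means $\mu_i\in\mathbb R^d$ and diagonal covariance matrices $\Sigma_i=\mathrm{diag}(\sigma_{i1}^2,\dots,\sigma_{id}^2)$, $\sigma_{ij}>0$. Let $M_1=\mathbb E[y]$, $M_3=\mathbb E[y^{\otimes 3}]$ be its moments, and let $\mathcal F=\sum_{i=1}^r\omega_i\mu_i^{\otimes3}=\sum_{i=1}^r p_i^{\otimes 3}$ with $p_i=\sqrt[3]{\omega_i}\,\mu_i$. For a family $G=(G(k,e_i+e_j))$, $k,i\in\{1,\dots,r\}$, $j\in\{r+1,\dots,n\}$, of complex numbers and a vector $\xi=(\xi_{r+1},\dots,\xi_n)$ of complex numbers let $N_l(G)$ be the $r\times r$ matrix with $(a,k)$ entry $G(k,e_a+e_l)$ and $N(\xi)=\sum_{l=r+1}^n\xi_lN_l(G)$.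 Call $G$ a generating matrix of $\mathcal F$ if $\sum_{k=1}^rG(k,e_i+e_j)\mathcal F_{0kt}=\mathcal F_{ijt}$ for all $i\in\{1,\dots,r\}$, $j\in\{r+1,\dots,n\}$, $t\in\{0,\dots,n\}$. **Assumptions on $\mathcal F$ and $\xi$.** (i) $(p_i)_0\ne0$ for all $i$; (ii) the vectors $((p_i)_k)_{1\le k\le r}$, $i=1,\dots,r$, are linearly independent; (iii) for each $j\in\{r+1,\dots,n\}$ the vectors $((p_i)_l)_{r+1\le l\le n,\ l\ne j}$, $i=1,\dots,r$, are linearly independent; (iv) for the generating matrix $G$ of $\mathcal F$ (which exists and is unique by (i)–(ii)) the eigenvalues of $N(\xi)$ are distinct from each other. **Algorithm.** Input: samples $y_1,\dots,y_N\in\mathbb R^d$ ($N\ge1$) and $r$. In every minimization problem below an arbitrary global minimizer is taken. 1. Compute $\widehat M_1=\frac1N\sum_i y_i$, $\widehat M_3=\frac1N\sum_i y_i^{\otimes3}$, and let $\widehat{\mathcal F}_\Omega=(\widehat M_3)_\Omega$. 2. (Tensor approximation.) (a) For all $1\le i\le r<j\le n$ let $\widehat G(\cdot,e_i+e_j)$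 minimize $\sum_{l\in\{r+1,\dots,n\}\setminus\{j\}}\bigl|\sum_{k=1}^r\widehat{\mathcal F}_{0kl}\,g_k-\widehat{\mathcal F}_{ijl}\bigr|^2$ over $g\in\mathbb C^r$. (b) Let $\hat v_1,\dots,\hat v_r\in\mathbb C^r$ be linearly independent unit eigenvectors of $\widehat N(\xi)=\sum_l\xi_lN_l(\widehat G)$, and $\hat w_k=(\hat v_k^HN_l(\widehat G)\hat v_k)_{r+1\le l\le n}$. (c) Let $\hat\beta\in\mathbb C^r$ minimize $\sum_{1\le i_1\le r<i_2\le n}|\widehat{\mathcal F}_{0i_1i_2}-\sum_k\beta_k(\hat v_k)_{i_1}(\hat w_k)_{i_2}|^2$, and let $\hat\theta\in\mathbb C^r$ minimize $\sum_{i_1\ne i_2\le r<i_3\le n}|\widehat{\mathcal F}_{i_1i_2i_3}-\sum_k\theta_k(\hat v_k)_{i_1}(\hat v_k)_{i_2}(\hat w_k)_{i_3}|^2$ (sum over $i_1,i_2\in\{1,\dots,r\}$). Put $\hat\lambda_k=\hat\beta_k^2/\hat\theta_k$, $\hat\gamma_k=\hat\theta_k/\hat\beta_k$, $\hat p_k=\sqrt[3]{\hat\lambda_k}\,(1,\hat\gamma_k\hat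 v_k,\hat w_k)$. The $\hat p_k$ serve only as starting points for (d), so their values (for instance if a denominator vanishes) do not restrict the result of (d). (d) Let $(p_1^*,\dots,p_r^*)\in(\mathbb C^d)^r$ minimize $\|(\sum_kq_k^{\otimes3}-\widehat{\mathcal F})_\Omega\|^2$. (e) Let $\hat q_i=\mathrm{Re}(\tau_ip_i^*)$, where $\tau_i$ is a cube root of $1$ that minimizes $\|\mathrm{Im}(\tau_ip_i^*)\|$. 3. Let $\beta^*$ minimize $\|\widehat M_1-\sum_i\beta_i\hat q_i\|^2$ over $\beta\in\mathbb R^r$, $\beta\ge0$; put $\hat\omega_i=(\beta_i^*)^{3/2}$, $\hat\mu_i=\hat q_i/\sqrt[3]{\hat\omega_i}$ (again only starting points, for step 4). 4. Let $(\omega_i^*,\mu_i^*)_{i\le r}$ minimize $\|\sum_i\omega_i\mu_i-\widehat M_1\|^2+\|\sum_i\omega_i(\mu_i^{\otimes3})_\Omega-(\widehat M_3)_\Omega\|^2$ over real $\omega_i\ge0$ with $\sum_i\omega_i=1$ and $\mu_i\in\mathbb R^d$. 5. Put $\widehat{\mathcal A}=\widehat M_3-\sum_i\hat q_i^{\otimes3}$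 and let $\hat a_j\in\mathbb R^d$ be given by $(\hat a_j)_j=\frac13\widehat{\mathcal A}_{jjj}$, $(\hat a_j)_i=\widehat{\mathcal A}_{jij}$ for $i\ne j$. For each $j$ let $(\beta_{1j}^*,\dots,\beta_{rj}^*)$ minimize $\|\hat a_j-\sum_i\omega_i^*\mu_i^*\beta_{ij}\|^2$ subject to $\beta_{ij}\ge0$, and put $\Sigma_i^*=\mathrm{diag}(\beta_{i1}^*,\dots,\beta_{id}^*)$. Output: $(\omega_i^*,\mu_i^*,\Sigma_i^*)$, $i=1,\dots,r$. **Theorem.** Under these assumptions there are constants $C,\delta>0$, depending only on the parameters $\{(\omega_i,\mu_i,\Sigma_i)\}_{i=1}^r$ and on $\xi$, such that for all $N\ge1$ and all samples $y_1,\dots,y_N\in\mathbb R^d$ with $\epsilon:=\max(\|M_3-\widehat M_3\|,\|M_1-\widehat M_1\|)<\delta$ the following holds. The algorithm can be carried out (all the eigenvectors and minimizers it asks for exist), and for every output $(\omega_i^*,\mu_i^*,\Sigma_i^*)_{i\le r}$ of it there is a permutation $\pi$ of $\{1,\dots,r\}$ such that for all $i$ $$\|\mu_i-\mu_{\pi(i)}^*\|\le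 C\epsilon,\qquad |\omega_i-\omega_{\pi(i)}^*|\le C\epsilon,\qquad \|\Sigma_i-\Sigma_{\pi(i)}^*\|\le C\epsilon .$$ -/

import Mathlib

open MeasureTheory ProbabilityTheory

/-- The Euclidean (Frobenius, Hilbert-Schmidt) norm of a finite family of real or complex numbers;
the index type may be that of a vector, a matrix, a tensor or a subtensor. -/
noncomputable def l2norm {𝕜 ι : Type} [RCLike 𝕜] [Fintype ι] (x : ι → 𝕜) : ℝ :=
  ‖(WithLp.toLp 2 x : EuclideanSpace 𝕜 ι)‖

/-- Third order tensors of dimension `d`; as in the tensor notation used throughout,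
the labels are `0, 1, …, d - 1`. -/
abbrev Tensor3 (𝕜 : Type) (d : ℕ) : Type := Fin d × Fin d × Fin d → 𝕜

/-- The tensor power `u ⊗ u ⊗ u`. -/
def tensorCube {𝕜 : Type} [RCLike 𝕜] {d : ℕ} (u : Fin d → 𝕜) : Tensor3 𝕜 d :=
  fun t => u t.1 * u t.2.1 * u t.2.2

/-- The label set `Ω` of triples of pairwise distinct labels. -/
abbrev Omega (d : ℕ) : Type :=
  {t : Fin d × Fin d × Fin d // t.1 ≠ t.2.1 ∧ t.2.1 ≠ t.2.2 ∧ t.1 ≠ t.2.2}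

/-- The labels `1, …, r`. -/
abbrev Head (d r : ℕ) : Type := {k : Fin d // 1 ≤ (k : ℕ) ∧ (k : ℕ) ≤ r}

/-- The labels `r + 1, …, n`, where `n = d - 1`. -/
abbrev Tail (d r : ℕ) : Type := {l : Fin d // r < (l : ℕ)}

section GeneratingMatrices

variable {d r : ℕ}

/-- `G k i j` stands for the entry `G(k, e_i + e_j)`, with `k, i ∈ [r]` and `j ∈ [r+1, n]`. -/
abbrev GenMatrix (d r : ℕ) : Type := Head d r → Head d r → Tail d r → ℂ

/-- `G` is a generating matrix of the symmetric tensor `F`: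
`∑ₖ G(k, e_i + e_j) F_{0kt} = F_{ijt}` for all `i ∈ [r]`, `j ∈ [r+1, n]`, `t = 0, …, n`. -/
def IsGeneratingMatrix [NeZero d] (F : Tensor3 ℂ d) (G : GenMatrix d r) : Prop :=
  ∀ (i : Head d r) (j : Tail d r) (t : Fin d),
    ∑ k : Head d r, G k i j * F (0, k.1, t) = F (i.1, j.1, t)

/-- The matrix `A_{ij}[F]` (it does not depend on `i`), with rows labelled by
`l ∈ [r+1, n]`, `l ≠ j`, and columns labelled by `k ∈ [r]`. -/
def coeffA [NeZero d] (F : Tensor3 ℂ d) (j : Tail d r) :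
    Matrix {l : Tail d r // l ≠ j} (Head d r) ℂ :=
  Matrix.of fun l k => F (0, k.1, l.1.1)

/-- The vector `b_{ij}[F]`. -/
def rhsB (F : Tensor3 ℂ d) (i : Head d r) (j : Tail d r) : {l : Tail d r // l ≠ j} → ℂ :=
  fun l => F (i.1, j.1, l.1.1)

/-- The matrix `N_l(G)`, whose `(a, k)` entry is `G(k, e_a + e_l)`. -/
def matN (G : GenMatrix d r) (l : Tail d r) : Matrix (Head d r) (Head d r) ℂ :=
  Matrix.of fun a k => G k a l

/-- The matrix `N(ξ) = ξ_{r+1} N_{r+1}(G) + ⋯ + ξ_n N_n(G)`. -/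
def matNxi (ξ : Tail d r → ℂ) (G : GenMatrix d r) : Matrix (Head d r) (Head d r) ℂ :=
  ∑ l : Tail d r, ξ l • matN G l

/-- The nondegeneracy conditions on the vectors of a decomposition
`F = p₁^{⊗3} + ⋯ + p_r^{⊗3}` and on `ξ`. -/
structure DecompConditions [NeZero d] (p : Fin r → Fin d → ℂ) (ξ : Tail d r → ℂ) : Prop where
  /-- The leading entries are nonzero. -/
  lead_ne_zero : ∀ i, p i 0 ≠ 0
  /-- The subvectors with labels `1, …, r` are linearly independent. -/
  head_indep : LinearIndependent ℂ (fun i : Fin r => fun k : Head d r => p i k.1)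
  /-- For each `j ∈ [r+1, n]`, the subvectors with labels in `[r+1, n] \ {j}` are
  linearly independent. -/
  tail_indep : ∀ j : Tail d r,
    LinearIndependent ℂ (fun i : Fin r => fun l : {l : Tail d r // l ≠ j} => p i l.1.1)
  /-- The eigenvalues of `N(ξ)`, formed with the generating matrix of `F`, are distinct. -/
  eigenvalues_distinct : ∀ G : GenMatrix d r,
    IsGeneratingMatrix (fun t => ∑ i, tensorCube (p i) t) G → (matNxi ξ G).charpoly.roots.Nodup

end GeneratingMatrices

/-- All the data produced when the incomplete symmetric tensor approximation algorithm is applied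
to the subtensor `F_Ω`, the rank `r` and the vector `ξ`. Only entries of `F` with labels in `Ω`
are used. Wherever the algorithm solves a minimization problem, any (global) minimizer may be
taken. The output is `pOpt`. -/
structure TensorApproxRun {d : ℕ} [NeZero d] (r : ℕ) (F : Tensor3 ℂ d) (ξ : Tail d r → ℂ) where
  /-- The matrix solving the linear least squares problems for `A_{ij}[F] g = b_{ij}[F]`. -/
  G : GenMatrix d r
  G_opt : ∀ (i : Head d r) (j : Tail d r),
    IsMinOn (fun g : Head d r → ℂ => l2norm ((coeffA F j).mulVec g - rhsB F i j) ^ 2)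
      Set.univ (fun k => G k i j)
  /-- Unit length eigenvectors of `N(ξ)`, forming a basis, and their eigenvalues. -/
  v : Fin r → Head d r → ℂ
  eigval : Fin r → ℂ
  v_unit : ∀ k, l2norm (v k) = 1
  v_eig : ∀ k, Module.End.HasEigenvector (Matrix.toLin' (matNxi ξ G)) (eigval k) (v k)
  v_indep : LinearIndependent ℂ v
  /-- The vectors `w_k = (v_k^H N_l(G) v_k)_l`. -/
  w : Fin r → Tail d r → ℂ
  w_eq : ∀ k l, w k l = star (v k) ⬝ᵥ (matN G l).mulVec (v k)
  /-- The linear least squares on the labels `(0, i₁, i₂)`, `i₁ ∈ [r]`, `i₂ ∈ [r+1, n]`. -/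
  β : Fin r → ℂ
  β_opt : IsMinOn (fun b : Fin r → ℂ =>
    l2norm (fun t : Head d r × Tail d r =>
      F (0, t.1.1, t.2.1) - ∑ k, b k * (v k t.1 * w k t.2)) ^ 2) Set.univ β
  /-- The linear least squares on the labels `(i₁, i₂, i₃)`,
  `i₁ ≠ i₂` in `[r]`, `i₃ ∈ [r+1, n]`. -/
  θ : Fin r → ℂ
  θ_opt : IsMinOn (fun b : Fin r → ℂ =>
    l2norm (fun t : {t : Head d r × Head d r × Tail d r // t.1 ≠ t.2.1} =>
      F (t.1.1.1, t.1.2.1.1, t.1.2.2.1)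
        - ∑ k, b k * (v k t.1.1 * v k t.1.2.1 * w k t.1.2.2)) ^ 2) Set.univ θ
  /-- The vectors `p̂_k = λ_k^{1/3} (1, γ_k v_k, w_k)` with `λ_k = β_k² / θ_k`, `γ_k = θ_k / β_k`.
  They are the starting points for the optimization that follows. -/
  pInit : Fin r → Fin d → ℂ
  pInit_zero : ∀ k, pInit k 0 = (β k ^ 2 / θ k) ^ (1 / 3 : ℂ)
  pInit_head : ∀ k (i : Head d r),
    pInit k i.1 = (β k ^ 2 / θ k) ^ (1 / 3 : ℂ) * (θ k / β k * v k i)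
  pInit_tail : ∀ k (l : Tail d r),
    pInit k l.1 = (β k ^ 2 / θ k) ^ (1 / 3 : ℂ) * w k l
  /-- A minimizer of `‖(∑ₖ q_k^{⊗3} - F)_Ω‖²`. -/
  pOpt : Fin r → Fin d → ℂ
  pOpt_opt : IsMinOn (fun q : Fin r → Fin d → ℂ =>
    l2norm (fun t : Omega d => ∑ k, tensorCube (q k) t.1 - F t.1) ^ 2) Set.univ pOpt

section Samples

variable {d N : ℕ}

/-- The sample average `(1/N) ∑ y_i`. -/
noncomputable def sampleM1 (y : Fin N → Fin d → ℝ) : Fin d → ℝ :=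
  fun a => (1 / (N : ℝ)) * ∑ i, y i a

/-- The sample third moment tensor `(1/N) ∑ y_i^{⊗3}`. -/
noncomputable def sampleM3 (y : Fin N → Fin d → ℝ) : Tensor3 ℝ d :=
  fun t => (1 / (N : ℝ)) * ∑ i, tensorCube (y i) t

/-- The objective `‖∑ ω_i μ_i - M̂₁‖² + ‖∑ ω_i (μ_i^{⊗3})_Ω - (M̂₃)_Ω‖²` of the joint optimization
over weights and means. -/
noncomputable def momentObjective {r : ℕ} (y : Fin N → Fin d → ℝ)
    (x : (Fin r → ℝ) × (Fin r → Fin d → ℝ)) : ℝ :=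
  l2norm (fun a : Fin d => ∑ i, x.1 i * x.2 i a - sampleM1 y a) ^ 2
    + l2norm (fun t : Omega d => ∑ i, x.1 i * tensorCube (x.2 i) t.1 - sampleM3 y t.1) ^ 2

/-- The vectors `â_j` with `(â_j)_j = A_{jjj} / 3` and `(â_j)_i = A_{jij}` for `i ≠ j`. -/
noncomputable def aVec (A : Tensor3 ℝ d) (j : Fin d) : Fin d → ℝ :=
  fun i => if i = j then A (j, j, j) / 3 else A (j, i, j)

end Samples

/-- All the data produced when the algorithm for learning diagonal Gaussian mixtures with `r`
components is applied to the samples `y`, with the vector `ξ` in its tensor approximation step.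
The output is `(weight, mean, covariance)`. -/
structure LearningRun {d N : ℕ} [NeZero d] (r : ℕ) (y : Fin N → Fin d → ℝ)
    (ξ : Tail d r → ℂ) where
  /-- The tensor approximation algorithm, applied to the sample third moments. -/
  tensorRun : TensorApproxRun r (fun t => (sampleM3 y t : ℂ)) ξ
  /-- The cube roots of unity that minimize the norm of the imaginary part. -/
  τ : Fin r → ℂ
  τ_cube : ∀ i, τ i ^ 3 = 1
  τ_opt : ∀ i (z : ℂ), z ^ 3 = 1 →
    l2norm (fun a => (τ i * tensorRun.pOpt i a).im) ≤ l2norm (fun a => (z * tensorRun.pOpt i a).im)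
  /-- The vectors `q̂_i = Re (τ_i p_i)`. -/
  q : Fin r → Fin d → ℝ
  q_eq : ∀ i a, q i a = (τ i * tensorRun.pOpt i a).re
  /-- The nonnegative least squares for the first moment; `β_i` estimates `ω_i^{2/3}`. -/
  β : Fin r → ℝ
  β_nonneg : ∀ i, 0 ≤ β i
  β_opt : IsMinOn (fun b : Fin r → ℝ => l2norm (fun a => sampleM1 y a - ∑ i, b i * q i a) ^ 2)
    {b | ∀ i, 0 ≤ b i} β
  /-- Initial weights and means for the optimization that follows. -/
  weightInit : Fin r → ℝ
  weightInit_eq : ∀ i, weightInit i = β i ^ (3 / 2 : ℝ)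
  meanInit : Fin r → Fin d → ℝ
  meanInit_eq : ∀ i a, meanInit i a = q i a / weightInit i ^ (1 / 3 : ℝ)
  /-- Optimal weights and means. -/
  weight : Fin r → ℝ
  mean : Fin r → Fin d → ℝ
  weight_nonneg : ∀ i, 0 ≤ weight i
  weight_sum : ∑ i, weight i = 1
  weight_mean_opt : IsMinOn (momentObjective y)
    {x : (Fin r → ℝ) × (Fin r → Fin d → ℝ) | (∀ i, 0 ≤ x.1 i) ∧ ∑ i, x.1 i = 1} (weight, mean)
  /-- `variance i j` estimates the variance `σ_{ij}²`; for each `j` it solves a nonnegative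
  least squares problem for the vector `â_j` obtained from `M̂₃ - ∑ q̂_i^{⊗3}`. -/
  variance : Fin r → Fin d → ℝ
  variance_nonneg : ∀ i j, 0 ≤ variance i j
  variance_opt : ∀ j, IsMinOn (fun b : Fin r → ℝ =>
    l2norm (fun a => aVec (fun t => sampleM3 y t - ∑ i, tensorCube (q i) t) j a
      - ∑ i, weight i * mean i a * b i) ^ 2) {b | ∀ i, 0 ≤ b i} (fun i => variance i j)
  covariance : Fin r → Matrix (Fin d) (Fin d) ℝ
  covariance_eq : ∀ i, covariance i = Matrix.diagonal (variance i)

/-- A Gaussian mixture model with `r` components of dimension `d` and diagonal, nonsingular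
covariance matrices `diag (σ_{i1}², …, σ_{id}²)`. -/
structure DiagGaussianMixture (d r : ℕ) where
  weight : Fin r → ℝ
  weight_pos : ∀ i, 0 < weight i
  weight_sum : ∑ i, weight i = 1
  mean : Fin r → Fin d → ℝ
  stdDev : Fin r → Fin d → ℝ
  stdDev_pos : ∀ i j, 0 < stdDev i j

namespace DiagGaussianMixture

variable {d r : ℕ} (P : DiagGaussianMixture d r)

/-- The covariance matrix of the `i`th component. -/
def covariance (i : Fin r) : Matrix (Fin d) (Fin d) ℝ :=
  Matrix.diagonal fun j => P.stdDev i j ^ 2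

/-- The law `∑ ω_i 𝒩(μ_i, Σ_i)`; a normal law with diagonal covariance matrix is the product of
its one-dimensional marginals. -/
noncomputable def law : Measure (Fin d → ℝ) :=
  ∑ i, ENNReal.ofReal (P.weight i) •
    Measure.pi fun j => gaussianReal (P.mean i j) ⟨P.stdDev i j ^ 2, sq_nonneg _⟩

/-- The mean `M₁ = 𝔼[y]`. -/
noncomputable def M1 : Fin d → ℝ := fun a => ∫ y, y a ∂P.law

/-- The third order moment tensor `M₃ = 𝔼[y ⊗ y ⊗ y]`. -/
noncomputable def M3 : Tensor3 ℝ d := fun t => ∫ y, tensorCube y t ∂P.law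

/-- The vectors `ω_i^{1/3} μ_i`, whose tensor cubes add up to `∑ ω_i μ_i^{⊗3}`. -/
noncomputable def decompVec (i : Fin r) : Fin d → ℂ :=
  fun a => ((P.weight i ^ (1 / 3 : ℝ) * P.mean i a : ℝ) : ℂ)

end DiagGaussianMixture

/-! The heart of the matter is stability of decompositions (`near_decomposition`, resting on
`near_blocks`): if the `Ω`-entries of `∑ q_k^{⊗3}` are within `O(η)` of those of `∑ p_k^{⊗3}`, then
`q` is within `O(η)` of `p`, up to a permutation and cube roots of unity. Split `q_k = (a_k, h_k,
t_k)` into the labels `0`, `1..r`, `r+1..n`. The entries `(0,k,j)` and `(i,j,j')` form a linear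
system of full column rank for the generating matrix, which therefore moves by `O(η)` only. Each
`N_l` has the eigenvectors `h_k` with eigenvalues `(t_k)_l / a_k`. Since `N(ξ)` has simple spectrum
in the limit, the `h_k` are determined up to scale (`near_eigenbasis`), and then so are the `t_k /
a_k`. The scalars left over solve further linear systems, which yield `a_k^3`; hence the cube roots
of unity.

A global minimizer is at least as good as the true parameters, whose residual is `O(ε)`. So the
moments of the minimizer are `O(ε)`-close to the exact ones, and stability applies. The starting
points of the optimizations play no role. For the vectors `q̂_i`, the imaginary part singles out the
right cube root (`near_re_of_min_im`). For weights and means, stability is applied to `ω_i^{1/3}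
μ_i`, and the first moment is then a linear system for `ω_i^{2/3}` (`near_weight_mean`). The
variances solve a linear problem of full column rank with perturbed data (`near_variance`).

The minimizers exist because the same stability estimates bound all nearly optimal points, so that
compactness applies; the eigenbasis exists because simplicity of the spectrum is an open condition.

To get constants that do not depend on the sample or on the choices made, all estimates are
`O`-statements along an arbitrary filter. In the end the filter lives on the type of all samples
together with all runs, and is pulled back from `𝓝 0` along the error; unfolding it gives `C` and
`δ`. -/

open Filter Topology Asymptotics in
/-- `f` tends to `c` along `l` at the rate `η`. -/
def Near {X E : Type} [NormedAddCommGroup E] (l : Filter X) (η : X → ℝ) (f : X → E) (c : E) :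
    Prop :=
  (fun x => f x - c) =O[l] η

/-! ### Calculus of limits with rate, and perturbation of linear systems. -/

namespace Near

open Filter Topology Asymptotics

variable {X E F : Type} [NormedAddCommGroup E] [NormedAddCommGroup F] {l : Filter X} {η : X → ℝ}

theorem const (c : E) : Near l η (fun _ => c) c := by
  simpa [Near] using isBigO_zero η l

theorem tendsto (hη : Tendsto η l (𝓝 0)) {f : X → E} {c : E} (h : Near l η f c) :
    Tendsto f l (𝓝 c) := by
  have := IsBigO.trans_tendsto h hη
  simpa using this.add_const c

theorem congr' {f g : X → E} {c : E} (h : Near l η f c) (hfg : ∀ᶠ x in l, f x = g x) :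
    Near l η g c :=
  IsBigO.congr' h (hfg.mono fun x hx => by simp [hx]) EventuallyEq.rfl

theorem add {f g : X → E} {c d : E} (hf : Near l η f c) (hg : Near l η g d) :
    Near l η (fun x => f x + g x) (c + d) :=
  (IsBigO.add hf hg).congr_left fun x => by beta_reduce; abel

theorem neg {f : X → E} {c : E} (hf : Near l η f c) : Near l η (fun x => -f x) (-c) :=
  (IsBigO.neg_left hf).congr_left fun x => by beta_reduce; abel

theorem sub {f g : X → E} {c d : E} (hf : Near l η f c) (hg : Near l η g d) :
    Near l η (fun x => f x - g x) (c - d) := by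
  simpa [sub_eq_add_neg] using hf.add hg.neg

theorem sum {ι : Type} (s : Finset ι) {f : ι → X → E} {c : ι → E}
    (h : ∀ i ∈ s, Near l η (f i) (c i)) : Near l η (fun x => ∑ i ∈ s, f i x) (∑ i ∈ s, c i) :=
  (IsBigO.fun_sum h).congr_left fun x => by simp

theorem of_norm_sub_le' {f : X → E} {c : E} {k : X → ℝ}
    (hk : k =O[l] η) (h : ∀ᶠ x in l, ‖f x - c‖ ≤ k x) : Near l η f c :=
  (IsBigO.of_bound 1 (h.mono fun x hx => by
    simpa using hx.trans (le_abs_self _))).trans hk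

theorem comp_differentiableAt {𝕜 : Type} [RCLike 𝕜] [NormedSpace 𝕜 E] [NormedSpace 𝕜 F]
    (hη : Tendsto η l (𝓝 0)) {f : X → E} {c : E} (hf : Near l η f c) {g : E → F}
    (hg : DifferentiableAt 𝕜 g c) : Near l η (fun x => g (f x)) (g c) :=
  (hg.isBigO_sub.comp_tendsto (hf.tendsto hη)).trans hf

theorem clm {𝕜 : Type} [RCLike 𝕜] [NormedSpace 𝕜 E] [NormedSpace 𝕜 F]
    {f : X → E} {c : E} (hf : Near l η f c) (L : E →L[𝕜] F) : Near l η (fun x => L (f x)) (L c) :=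
  ((L.isBigO_comp (fun x => f x - c) l).trans hf).congr_left fun x => by simp

theorem pi {ι : Type} [Fintype ι] {f : X → ι → E} {c : ι → E}
    (h : ∀ i, Near l η (fun x => f x i) (c i)) : Near l η f c :=
  isBigO_pi.2 h

theorem apply {ι : Type} [Fintype ι] {f : X → ι → E} {c : ι → E} (h : Near l η f c) (i : ι) :
    Near l η (fun x => f x i) (c i) :=
  isBigO_pi.1 h i

section Field

variable {𝕜 : Type} [RCLike 𝕜]

theorem mul (hη : Tendsto η l (𝓝 0)) {f g : X → 𝕜} {a b : 𝕜} (hf : Near l η f a)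
    (hg : Near l η g b) : Near l η (fun x => f x * g x) (a * b) := by
  have h1 : (fun x => (f x - a) * g x) =O[l] fun x => η x * (1 : ℝ) :=
    IsBigO.mul hf ((hg.tendsto hη).isBigO_one ℝ)
  have h2 : (fun x => a * (g x - b)) =O[l] η := IsBigO.const_mul_left hg a
  simp only [mul_one] at h1
  exact (h1.add h2).congr_left fun x => by ring

theorem const_mul {f : X → 𝕜} {a : 𝕜} (c : 𝕜) (hf : Near l η f a) :
    Near l η (fun x => c * f x) (c * a) :=
  (IsBigO.const_mul_left hf c).congr_left fun x => by ring

theorem inv (hη : Tendsto η l (𝓝 0)) {f : X → 𝕜} {a : 𝕜} (hf : Near l η f a) (ha : a ≠ 0) :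
    Near l η (fun x => (f x)⁻¹) a⁻¹ :=
  hf.comp_differentiableAt (𝕜 := 𝕜) hη (g := fun z => z⁻¹) (differentiableAt_inv ha)

theorem div (hη : Tendsto η l (𝓝 0)) {f g : X → 𝕜} {a b : 𝕜} (hf : Near l η f a)
    (hg : Near l η g b) (hb : b ≠ 0) : Near l η (fun x => f x / g x) (a / b) := by
  simpa [div_eq_mul_inv] using hf.mul hη (hg.inv hη hb)

theorem eventually_ne (hη : Tendsto η l (𝓝 0)) {f : X → 𝕜} {a : 𝕜} (hf : Near l η f a)
    (ha : a ≠ 0) : ∀ᶠ x in l, f x ≠ 0 :=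
  (hf.tendsto hη).eventually_ne ha

end Field

theorem ofReal {f : X → ℝ} {a : ℝ} (hf : Near l η f a) :
    Near l η (fun x => (f x : ℂ)) (a : ℂ) :=
  hf.clm Complex.ofRealCLM

theorem re {f : X → ℂ} {a : ℂ} (hf : Near l η f a) : Near l η (fun x => (f x).re) a.re :=
  hf.clm Complex.reCLM

theorem im {f : X → ℂ} {a : ℂ} (hf : Near l η f a) : Near l η (fun x => (f x).im) a.im :=
  hf.clm Complex.imCLM

/-- Entrywise perturbations of an injective linear map are uniformly bounded below. -/
theorem eventually_lower_bound {𝕜 ι κ : Type} [RCLike 𝕜] [Fintype ι] [Fintype κ]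
    {A : X → ι → κ → 𝕜} {A₀ : ι → κ → 𝕜} (hA : ∀ i k, Tendsto (fun x => A x i k) l (𝓝 (A₀ i k)))
    (hinj : ∀ u : κ → 𝕜, (∀ i, ∑ k, u k * A₀ i k = 0) → u = 0) :
    ∃ c > 0, ∀ᶠ x in l, ∀ u : κ → 𝕜, c * ‖u‖ ≤ ‖fun i => ∑ k, u k * A x i k‖ := by
  let f : (κ → 𝕜) →ₗ[𝕜] (ι → 𝕜) :=
    { toFun := fun u i => ∑ k, u k * A₀ i k
      map_add' := fun u v => by ext i; simp [add_mul, Finset.sum_add_distrib]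
      map_smul' := fun c u => by ext i; simp [mul_assoc, Finset.mul_sum] }
  have hf : LinearMap.ker f = ⊥ := by
    rw [LinearMap.ker_eq_bot']
    intro u hu
    exact hinj u fun i => congrFun hu i
  obtain ⟨K, hK, hanti⟩ := LinearMap.exists_antilipschitzWith f hf
  have hlow : ∀ u, ‖u‖ ≤ K * ‖f u‖ := fun u => by
    simpa using hanti.le_mul_dist u 0
  have hK' : (0 : ℝ) < K := hK
  have hsum : Tendsto (fun x => ∑ i, ∑ k, ‖A x i k - A₀ i k‖) l (𝓝 0) := by
    have : Tendsto (fun x => ∑ i, ∑ k, ‖A x i k - A₀ i k‖) l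
        (𝓝 (∑ i : ι, ∑ k : κ, ‖A₀ i k - A₀ i k‖)) :=
      tendsto_finsetSum _ fun i _ => tendsto_finsetSum _ fun k _ =>
        ((hA i k).sub_const _).norm
    simpa using this
  -- The limit map is bounded below by `1/K`; half of this is spent on the perturbation, the other
  -- half remains.
  refine ⟨(2 * K)⁻¹, by positivity, ?_⟩
  filter_upwards [hsum.eventually (gt_mem_nhds (show (0 : ℝ) < (2 * K)⁻¹ by positivity))]
    with x hx u
  have h1 : ‖(fun i => ∑ k, u k * A x i k) - f u‖ ≤ (2 * (K : ℝ))⁻¹ * ‖u‖ := by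
    rw [pi_norm_le_iff_of_nonneg (by positivity)]
    intro i
    have : ((fun i => ∑ k, u k * A x i k) - f u) i = ∑ k, u k * (A x i k - A₀ i k) := by
      simp [f, mul_sub, Finset.sum_sub_distrib]
    rw [this]
    calc ‖∑ k, u k * (A x i k - A₀ i k)‖ ≤ ∑ k, ‖u‖ * ‖A x i k - A₀ i k‖ := by
          refine (norm_sum_le _ _).trans (Finset.sum_le_sum fun k _ => ?_)
          rw [norm_mul]
          gcongr
          exact norm_le_pi_norm u k
      _ = (∑ k, ‖A x i k - A₀ i k‖) * ‖u‖ := by rw [← Finset.mul_sum, mul_comm]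
      _ ≤ (2 * (K : ℝ))⁻¹ * ‖u‖ := by
          gcongr
          refine le_trans ?_ hx.le
          exact Finset.single_le_sum (f := fun i => ∑ k, ‖A x i k - A₀ i k‖)
            (fun i _ => Finset.sum_nonneg fun k _ => norm_nonneg _) (Finset.mem_univ i)
  have h2 := hlow u
  have h3 : ‖f u‖ ≤ ‖fun i => ∑ k, u k * A x i k‖ + (2 * (K : ℝ))⁻¹ * ‖u‖ := by
    calc ‖f u‖ = ‖(fun i => ∑ k, u k * A x i k) - ((fun i => ∑ k, u k * A x i k) - f u)‖ := by
          congr 1; abel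
      _ ≤ _ := (norm_sub_le _ _).trans (by gcongr)
  have h4 : (K : ℝ)⁻¹ * ‖u‖ ≤ ‖f u‖ := by
    rw [inv_mul_le_iff₀ hK']; exact h2
  have h5 : (K : ℝ)⁻¹ = 2 * (2 * (K : ℝ))⁻¹ := by field_simp
  rw [h5] at h4
  linarith

/-- Solutions of a linear system with trivial kernel depend in a Lipschitz way on the data. -/
theorem solve {𝕜 ι κ : Type} [RCLike 𝕜] [Fintype ι] [Fintype κ] (hη : Tendsto η l (𝓝 0))
    {A : X → ι → κ → 𝕜} {A₀ : ι → κ → 𝕜} (hA : ∀ i k, Near l η (fun x => A x i k) (A₀ i k))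
    (hinj : ∀ u : κ → 𝕜, (∀ i, ∑ k, u k * A₀ i k = 0) → u = 0) {u : X → κ → 𝕜} {u₀ : κ → 𝕜}
    (h : ∀ i, Near l η (fun x => ∑ k, u x k * A x i k) (∑ k, u₀ k * A₀ i k)) (k : κ) :
    Near l η (fun x => u x k) (u₀ k) := by
  obtain ⟨c, hc, hlow⟩ :=
    eventually_lower_bound (fun i k => (hA i k).tendsto hη) hinj
  -- Comparing `u` with `u₀` in the perturbed system, rather than in the limit one, avoids any a
  -- priori bound on `u`.
  have h1 : ∀ i, Near l η (fun x => ∑ k, u x k * A x i k - ∑ k, u₀ k * A x i k) 0 := fun i => by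
    have := (h i).sub (Near.sum Finset.univ fun k _ => (hA i k).const_mul (u₀ k))
    simpa using this
  have h2 : Near l η (fun x i => ∑ k, u x k * A x i k - ∑ k, u₀ k * A x i k) 0 := Near.pi h1
  have h3 : (fun x => u x - u₀) =O[l] η := by
    refine IsBigO.trans (IsBigO.of_bound c⁻¹ ?_) h2
    filter_upwards [hlow] with x hx
    rw [← div_eq_inv_mul, le_div_iff₀ hc, mul_comm]
    refine (hx (u x - u₀)).trans (le_of_eq ?_)
    congr 1
    ext i
    simp [sub_mul, Finset.sum_sub_distrib]
  exact Near.apply (c := u₀) h3 k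

end Near

/-! ### Elementary properties of the Euclidean norm. -/

section L2norm

variable {𝕜 ι : Type} [RCLike 𝕜] [Fintype ι]

theorem l2norm_nonneg (x : ι → 𝕜) : 0 ≤ l2norm x := norm_nonneg _

theorem norm_le_l2norm (x : ι → 𝕜) (i : ι) : ‖x i‖ ≤ l2norm x :=
  PiLp.norm_apply_le (WithLp.toLp 2 x : EuclideanSpace 𝕜 ι) i

theorem pi_norm_le_l2norm (x : ι → 𝕜) : ‖x‖ ≤ l2norm x :=
  (pi_norm_le_iff_of_nonneg (l2norm_nonneg x)).2 (norm_le_l2norm x)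

theorem l2norm_sq (x : ι → 𝕜) : l2norm x ^ 2 = ∑ i, ‖x i‖ ^ 2 :=
  EuclideanSpace.norm_sq_eq _

theorem l2norm_le_sum (x : ι → 𝕜) : l2norm x ≤ ∑ i, ‖x i‖ := by
  refine le_of_sq_le_sq ?_ (Finset.sum_nonneg fun _ _ => norm_nonneg _)
  rw [l2norm_sq]
  exact Finset.sum_sq_le_sq_sum_of_nonneg fun _ _ => norm_nonneg _

theorem continuous_l2norm : Continuous (l2norm : (ι → 𝕜) → ℝ) :=
  continuous_norm.comp (PiLp.continuous_toLp 2 _)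

theorem l2norm_neg (x : ι → 𝕜) : l2norm (-x) = l2norm x := by
  rw [l2norm, WithLp.toLp_neg, norm_neg, l2norm]

theorem l2norm_add_le (x y : ι → 𝕜) : l2norm (x + y) ≤ l2norm x + l2norm y := by
  rw [l2norm, WithLp.toLp_add]
  exact norm_add_le _ _

open Filter Asymptotics in
theorem isBigO_l2norm {X : Type} {l : Filter X} {η : X → ℝ} {f : X → ι → 𝕜} {c : ι → 𝕜}
    (h : ∀ i, Near l η (fun x => f x i) (c i)) :
    (fun x => l2norm (fun i => f x i - c i)) =O[l] η := by
  refine IsBigO.trans (IsBigO.of_bound 1 (Eventually.of_forall fun x => ?_))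
    (IsBigO.fun_sum (s := Finset.univ) fun i _ => IsBigO.norm_left (h i))
  rw [one_mul, Real.norm_of_nonneg (l2norm_nonneg _)]
  exact (l2norm_le_sum _).trans (le_abs_self _)

end L2norm

/-- Permutations and generating matrices exist only close to the limit; an arbitrary value elsewhere
makes them functions on all of `X`. -/
theorem Filter.Eventually.exists_choice {X Y : Type} [Nonempty Y] {l : Filter X}
    {P : X → Y → Prop} (h : ∀ᶠ x in l, ∃ y, P x y) : ∃ f : X → Y, ∀ᶠ x in l, P x (f x) := by
  classical
  refine ⟨fun x => if hx : ∃ y, P x y then hx.choose else Classical.arbitrary Y, ?_⟩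
  filter_upwards [h] with x hx
  rw [dif_pos hx]
  exact hx.choose_spec

/-! ### Perturbation of eigenvectors for simple spectrum. -/

section Eigen

open Filter Topology Asymptotics

/-- In an eigenbasis, `det (z - N)` is the product of the `z - λ_s`. -/
theorem det_smul_one_sub_eq_prod {ι κ : Type} [Fintype ι] [DecidableEq ι] [Fintype κ]
    [DecidableEq κ] (N : Matrix κ κ ℂ) (b : Module.Basis ι ℂ (κ → ℂ)) (ev : ι → ℂ)
    (h : ∀ s, N.mulVec (b s) = ev s • b s) (z : ℂ) :
    (z • (1 : Matrix κ κ ℂ) - N).det = ∏ s, (z - ev s) := by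
  have : LinearMap.toMatrix b b (Matrix.toLin' (z • (1 : Matrix κ κ ℂ) - N))
      = Matrix.diagonal fun s => z - ev s := by
    ext i j
    rw [LinearMap.toMatrix_apply, Matrix.toLin'_apply, Matrix.sub_mulVec, h, Matrix.smul_mulVec,
      Matrix.one_mulVec, ← sub_smul, map_smul, b.repr_self, Matrix.diagonal_apply]
    simp only [Finsupp.smul_apply, Finsupp.single_apply, smul_eq_mul, mul_ite, mul_one, mul_zero]
    by_cases hij : i = j
    · subst hij; simp
    · simp [hij, Ne.symm hij]
  rw [← LinearMap.det_toLin', ← LinearMap.det_toMatrix b, this, Matrix.det_diagonal]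

theorem exists_gap {ι : Type} [Finite ι] {ev : ι → ℂ} (hinj : Function.Injective ev) :
    ∃ g > 0, ∀ i j, i ≠ j → g ≤ ‖ev i - ev j‖ := by
  classical
  cases nonempty_fintype ι
  by_cases hne : (Finset.univ.filter fun t : ι × ι => t.1 ≠ t.2).Nonempty
  · obtain ⟨t, ht, hmin⟩ := Finset.exists_min_image _ (fun t : ι × ι => ‖ev t.1 - ev t.2‖) hne
    refine ⟨‖ev t.1 - ev t.2‖, ?_, fun i j hij => hmin (i, j) (by simpa using hij)⟩
    rw [gt_iff_lt, norm_pos_iff, sub_ne_zero]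
    exact fun h => (Finset.mem_filter.1 ht).2 (hinj h)
  · refine ⟨1, one_pos, fun i j hij => (hne ⟨(i, j), by simpa using hij⟩).elim⟩

theorem exists_norm_lt_of_norm_prod_lt {ι : Type} [Fintype ι] {f : ι → ℂ} {ρ : ℝ} (hρ : 0 < ρ)
    (h : ‖∏ s, f s‖ < ρ ^ Fintype.card ι) : ∃ s, ‖f s‖ < ρ := by
  by_contra! hcon
  refine absurd h (not_lt.2 ?_)
  rw [norm_prod, ← Finset.card_univ, ← Finset.prod_const]
  exact Finset.prod_le_prod (fun _ _ => hρ.le) fun i _ => hcon i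

variable {X : Type} {l : Filter X} {η : X → ℝ}

/-- Eigenvectors of a matrix near a diagonal matrix with simple spectrum, for eigenvalues close to
`μ₀ k`, are close to multiples of the `k`th standard basis vector. -/
theorem near_eigenvector_diagonal {ι : Type} [Fintype ι] [DecidableEq ι]
    (hη : Tendsto η l (𝓝 0)) {B : X → Matrix ι ι ℂ} {ev₀ : ι → ℂ}
    (hB : ∀ i j, Near l η (fun x => B x i j) (Matrix.diagonal ev₀ i j))
    {g : ℝ} (hg : 0 < g) (hgap : ∀ i j, i ≠ j → g ≤ ‖ev₀ i - ev₀ j‖)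
    (k : ι) {ev : X → ℂ} {y : X → ι → ℂ} (hy : ∀ᶠ x in l, (B x).mulVec (y x) = ev x • y x)
    (hy0 : ∀ᶠ x in l, y x ≠ 0) (hev : ∀ᶠ x in l, ‖ev₀ k - ev x‖ < g / 2) :
    (∀ᶠ x in l, y x k ≠ 0) ∧
      ∀ i, Near l η (fun x => (y x k)⁻¹ * y x i) ((Pi.single k 1 : ι → ℂ) i) := by
  set E : X → ℝ := fun x => ∑ i, ∑ j, ‖B x i j - Matrix.diagonal ev₀ i j‖ with hE
  have hEO : E =O[l] η := IsBigO.fun_sum fun i _ => IsBigO.fun_sum fun j _ => (hB i j).norm_left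
  have hE0 : Tendsto E l (𝓝 0) := hEO.trans_tendsto hη
  have hEnn : ∀ x, 0 ≤ E x := fun x =>
    Finset.sum_nonneg fun _ _ => Finset.sum_nonneg fun _ _ => norm_nonneg _
  -- Row `i` of `(B - diag ev₀) y` is `(ev - ev₀ i) y i`. It is at most `E ‖y‖`, while `|ev - ev₀ i|
  -- ≥ g / 2` because `ev` lies within `g / 2` of `ev₀ k`.
  have hoff : ∀ᶠ x in l, ∀ i, i ≠ k → ‖y x i‖ ≤ 2 / g * E x * ‖y x‖ := by
    filter_upwards [hy, hev] with x hx hevx i hik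
    have h1 : ∑ j, (B x i j - Matrix.diagonal ev₀ i j) * y x j = (ev x - ev₀ i) * y x i := by
      have := congrFun hx i
      simp only [Matrix.mulVec, dotProduct, Pi.smul_apply, smul_eq_mul] at this
      simp only [sub_mul, Finset.sum_sub_distrib, this]
      congr 1
      simp [Matrix.diagonal_apply]
    have h2 : ‖∑ j, (B x i j - Matrix.diagonal ev₀ i j) * y x j‖ ≤ E x * ‖y x‖ := by
      calc _ ≤ ∑ j, ‖B x i j - Matrix.diagonal ev₀ i j‖ * ‖y x‖ := by
            refine (norm_sum_le _ _).trans (Finset.sum_le_sum fun j _ => ?_)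
            rw [norm_mul]
            gcongr
            exact norm_le_pi_norm _ j
        _ ≤ E x * ‖y x‖ := by
            rw [← Finset.sum_mul]
            gcongr
            exact Finset.single_le_sum
              (f := fun i => ∑ j, ‖B x i j - Matrix.diagonal ev₀ i j‖)
              (fun i _ => Finset.sum_nonneg fun k _ => norm_nonneg _) (Finset.mem_univ i)
    have h3 : g / 2 ≤ ‖ev x - ev₀ i‖ := by
      have h4 := hgap k i (Ne.symm hik)
      have h5 := norm_add_le (ev₀ k - ev x) (ev x - ev₀ i)
      rw [sub_add_sub_cancel] at h5
      linarith
    rw [h1, norm_mul] at h2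
    have h6 : g / 2 * ‖y x i‖ ≤ E x * ‖y x‖ :=
      (mul_le_mul_of_nonneg_right h3 (norm_nonneg _)).trans h2
    calc ‖y x i‖ = 2 / g * (g / 2 * ‖y x i‖) := by field_simp
      _ ≤ 2 / g * (E x * ‖y x‖) := by gcongr
      _ = _ := by ring
  have hsmall : ∀ᶠ x in l, 2 / g * E x < 1 / 2 := by
    have : Tendsto (fun x => 2 / g * E x) l (𝓝 (2 / g * 0)) := hE0.const_mul _
    exact this.eventually (gt_mem_nhds (by norm_num))
  -- All other coordinates are now at most half the sup norm, so the sup norm is attained at `k`.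
  have hdom : ∀ᶠ x in l, ‖y x‖ ≤ ‖y x k‖ := by
    filter_upwards [hoff, hsmall, hy0] with x hx hs h0
    have hpos : 0 < ‖y x‖ := norm_pos_iff.2 h0
    by_contra! hlt
    have : ‖y x‖ ≤ max ‖y x k‖ (1 / 2 * ‖y x‖) := by
      rw [pi_norm_le_iff_of_nonneg (by positivity)]
      intro i
      by_cases hik : i = k
      · subst hik; exact le_max_left _ _
      · refine ((hx i hik).trans ?_).trans (le_max_right _ _)
        gcongr
    rcases le_max_iff.1 this with h | h <;> linarith
  have hk0 : ∀ᶠ x in l, y x k ≠ 0 := by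
    filter_upwards [hdom, hy0] with x hx h0
    rw [← norm_pos_iff]
    exact (norm_pos_iff.2 h0).trans_le hx
  refine ⟨hk0, fun i => ?_⟩
  by_cases hik : i = k
  · subst hik
    rw [Pi.single_eq_same]
    exact (Near.const 1).congr' (hk0.mono fun x hx => (inv_mul_cancel₀ hx).symm)
  · rw [Pi.single_eq_of_ne hik]
    refine Near.of_norm_sub_le' (hEO.const_mul_left (2 / g)) ?_
    filter_upwards [hoff, hdom, hk0] with x hx hd h0
    have hpos : 0 < ‖y x k‖ := norm_pos_iff.2 h0
    rw [sub_zero, norm_mul, norm_inv, inv_mul_le_iff₀ hpos, mul_comm]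
    refine (hx i hik).trans ?_
    have := hEnn x
    gcongr

/-- If `N x` is near a matrix with simple spectrum, any eigenbasis of `N x` is, after a permutation
and a rescaling, near a given eigenbasis of the limit. -/
theorem near_eigenbasis {ι κ : Type} [Fintype ι] [DecidableEq ι] [Fintype κ] [DecidableEq κ]
    (hη : Tendsto η l (𝓝 0)) (hcard : Fintype.card ι = Fintype.card κ) {N : X → Matrix κ κ ℂ}
    {N₀ : Matrix κ κ ℂ} (hN : ∀ i j, Near l η (fun x => N x i j) (N₀ i j)) {ev₀ : ι → ℂ}
    (hev₀ : Function.Injective ev₀) {v₀ : ι → κ → ℂ}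
    (hv₀ : ∀ k, N₀.mulVec (v₀ k) = ev₀ k • v₀ k) (hind₀ : LinearIndependent ℂ v₀)
    {ev : X → ι → ℂ} {v : X → ι → κ → ℂ}
    (hv : ∀ᶠ x in l, ∀ s, (N x).mulVec (v x s) = ev x s • v x s)
    (hind : ∀ᶠ x in l, LinearIndependent ℂ (v x)) :
    ∃ (σ : X → Equiv.Perm ι) (c : X → ι → ℂ), ∀ k, (∀ᶠ x in l, c x k ≠ 0) ∧
      ∀ i, Near l η (fun x => (c x k)⁻¹ * v x (σ x k) i) (v₀ k i) := by
  have hfin : Fintype.card ι = Module.finrank ℂ (κ → ℂ) := by simpa using hcard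
  rcases isEmpty_or_nonempty ι with hem | hne
  · exact ⟨fun _ => 1, fun _ _ => 1, fun k => hem.elim k⟩
  obtain ⟨g, hg, hgap⟩ := exists_gap hev₀
  let b := basisOfLinearIndependentOfCardEqFinrank hind₀ hfin
  have hb : ∀ k, b k = v₀ k := fun k => by simp [b]
  have hNt : Tendsto N l (𝓝 N₀) :=
    tendsto_pi_nhds.2 fun i => tendsto_pi_nhds.2 fun j => (hN i j).tendsto hη
  -- `det (ev₀ k - N x)` tends to `0` and is the product of the `ev₀ k - ev x s`, so some factor is
  -- small. No rate is needed here.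
  have hclose : ∀ k, ∀ᶠ x in l, ∃ s, ‖ev₀ k - ev x s‖ < g / 2 := fun k => by
    have h1 : Tendsto (fun x => ‖(ev₀ k • (1 : Matrix κ κ ℂ) - N x).det‖) l (𝓝 0) := by
      have hc : Continuous fun M : Matrix κ κ ℂ => ‖(ev₀ k • (1 : Matrix κ κ ℂ) - M).det‖ :=
        (Continuous.matrix_det (continuous_const.sub continuous_id)).norm
      have h2 := (hc.tendsto N₀).comp hNt
      have h3 : (ev₀ k • (1 : Matrix κ κ ℂ) - N₀).det = 0 := by
        rw [det_smul_one_sub_eq_prod N₀ b ev₀ (fun s => by rw [hb, hv₀])]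
        exact Finset.prod_eq_zero (Finset.mem_univ k) (sub_self _)
      simpa [h3, Function.comp_def] using h2
    have hpos : (0 : ℝ) < (g / 2) ^ Fintype.card ι := by positivity
    filter_upwards [h1.eventually (gt_mem_nhds hpos), hv, hind] with x hx hvx hix
    rw [det_smul_one_sub_eq_prod (N x) (basisOfLinearIndependentOfCardEqFinrank hix hfin) (ev x)
      (fun s => by simpa using hvx s)] at hx
    exact exists_norm_lt_of_norm_prod_lt (by positivity) hx
  -- One eigenvalue cannot be within `g / 2` of two limits at distance at least `g`, so the matching
  -- is injective.
  have hperm : ∀ᶠ x in l, ∃ σ : Equiv.Perm ι, ∀ k, ‖ev₀ k - ev x (σ k)‖ < g / 2 := by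
    filter_upwards [eventually_all.2 hclose] with x hx
    choose f hf using hx
    have hinj : Function.Injective f := by
      intro i j hij
      by_contra hne
      have h1 := hgap i j hne
      have h2 := norm_sub_le (ev₀ i - ev x (f i)) (ev₀ j - ev x (f j))
      rw [hij, sub_sub_sub_cancel_right] at h2
      have h3 := hf i
      have h4 := hf j
      rw [hij] at h3
      linarith
    exact ⟨Equiv.ofBijective f (Finite.injective_iff_bijective.1 hinj), hf⟩
  obtain ⟨σ, hσ⟩ := hperm.exists_choice
  -- In the limiting eigenbasis `b` the limit matrix is diagonal; the scale `c` is the dominant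
  -- coordinate of the eigenvector there.
  refine ⟨σ, fun x k => b.repr (v x (σ x k)) k, fun k => ?_⟩
  have hB : ∀ i j, Near l η (fun x => LinearMap.toMatrix b b (Matrix.toLin' (N x)) i j)
      (Matrix.diagonal ev₀ i j) := fun i j => by
    have h1 : Near l η (fun x => (N x).mulVec (v₀ j)) (N₀.mulVec (v₀ j)) := by
      refine Near.pi fun a => ?_
      simp only [Matrix.mulVec, dotProduct, mul_comm (N₀ a _), mul_comm (N _ a _)]
      exact Near.sum _ fun k _ => (hN a k).const_mul _
    have h2 := h1.clm (LinearMap.toContinuousLinearMap (b.coord i))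
    have h3 : b.coord i (N₀.mulVec (v₀ j)) = Matrix.diagonal ev₀ i j := by
      rw [hv₀, ← hb, map_smul, Module.Basis.coord_apply, b.repr_self, Matrix.diagonal_apply,
        Finsupp.single_apply]
      by_cases hij : i = j
      · subst hij; simp
      · simp [hij, Ne.symm hij]
    simp only [LinearMap.coe_toContinuousLinearMap', h3] at h2
    simpa [LinearMap.toMatrix_apply, hb] using h2
  have hy : ∀ᶠ x in l, (LinearMap.toMatrix b b (Matrix.toLin' (N x))).mulVec
      (b.repr (v x (σ x k))) = ev x (σ x k) • ⇑(b.repr (v x (σ x k))) := by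
    filter_upwards [hv] with x hx
    rw [LinearMap.toMatrix_mulVec_repr, Matrix.toLin'_apply, hx, map_smul, Finsupp.coe_smul]
  have hy0 : ∀ᶠ x in l, (⇑(b.repr (v x (σ x k))) : ι → ℂ) ≠ 0 := by
    filter_upwards [hind] with x hx h0
    refine hx.ne_zero (σ x k) ?_
    rw [← b.repr.map_eq_zero_iff]
    exact DFunLike.coe_injective h0
  obtain ⟨h1, h2⟩ := near_eigenvector_diagonal hη hB hg hgap k hy hy0
    (hσ.mono fun x hx => hx k)
  refine ⟨h1, fun i => ?_⟩
  have h3 := Near.sum Finset.univ fun j _ => (h2 j).const_mul (v₀ j i)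
  have h4 : ∑ j, v₀ j i * (Pi.single k 1 : ι → ℂ) j = v₀ k i := by
    simp [Pi.single_apply]
  rw [h4] at h3
  refine h3.congr' (Eventually.of_forall fun x => ?_)
  have h5 := congrFun (b.sum_repr (v x (σ x k))) i
  rw [Finset.sum_apply] at h5
  rw [← h5, Finset.mul_sum]
  refine Finset.sum_congr rfl fun j _ => ?_
  rw [Pi.smul_apply, hb, smul_eq_mul]
  ring

end Eigen

/-! ### Recovering the blocks of a decomposition from entries with distinct labels. -/

section Blocks

open Filter Topology Asymptotics

variable {ι κ T : Type} [Fintype ι] [Fintype κ]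

theorem exists_dot_eq [DecidableEq κ] (hcard : Fintype.card ι = Fintype.card κ) {h : ι → κ → ℂ}
    (hh : LinearIndependent ℂ h) (c : ι → ℂ) : ∃ u : κ → ℂ, ∀ s, ∑ k, u k * h s k = c s := by
  have hfin : Fintype.card ι = Module.finrank ℂ (κ → ℂ) := by simpa using hcard
  rcases isEmpty_or_nonempty ι with hem | hne
  · exact ⟨0, fun s => hem.elim s⟩
  let b := basisOfLinearIndependentOfCardEqFinrank hh hfin
  have hb : ∀ k, b k = h k := fun k => by simp [b]
  refine ⟨fun k => b.constr ℂ c (Pi.single k 1), fun s => ?_⟩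
  have h1 : b.constr ℂ c (h s) = c s := by rw [← hb, b.constr_basis]
  rw [← h1]
  conv_rhs => rw [pi_eq_sum_univ' (h s)]
  rw [map_sum]
  refine Finset.sum_congr rfl fun k _ => ?_
  rw [map_smul, smul_eq_mul, mul_comm]

theorem eq_zero_of_dot_eq_zero [DecidableEq κ] (hcard : Fintype.card ι = Fintype.card κ)
    {h : ι → κ → ℂ} (hh : LinearIndependent ℂ h) {u : κ → ℂ} (hu : ∀ s, ∑ k, u k * h s k = 0) :
    u = 0 := by
  have hspan : Submodule.span ℂ (Set.range h) = ⊤ :=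
    hh.span_eq_top_of_card_eq_finrank' (by simpa using hcard)
  let φ : (κ → ℂ) →ₗ[ℂ] ℂ :=
    { toFun := fun v => ∑ k, u k * v k
      map_add' := fun v w => by simp [mul_add, Finset.sum_add_distrib]
      map_smul' := fun c v => by
        simp only [Pi.smul_apply, smul_eq_mul, RingHom.id_apply, Finset.mul_sum]
        exact Finset.sum_congr rfl fun k _ => by ring }
  have hφ : φ = 0 := LinearMap.ext_on_range hspan fun s => by simpa [φ] using hu s
  ext k
  simpa [φ, Pi.single_apply] using LinearMap.congr_fun hφ (Pi.single k 1)

/-- A factorization `∑ₛ aₛ hₛ ⊗ tₛ` with injective value has independent `hₛ` and nonzero `aₛ`. -/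
theorem indep_and_ne_zero_of_factor_injective [DecidableEq ι] [DecidableEq κ]
    (hcard : Fintype.card ι = Fintype.card κ) {a : ι → ℂ} {h : ι → κ → ℂ} {t : ι → T → ℂ}
    (hinj : ∀ u : κ → ℂ, (∀ l, ∑ k, u k * ∑ s, a s * h s k * t s l = 0) → u = 0) :
    LinearIndependent ℂ h ∧ ∀ s, a s ≠ 0 := by
  let f : (κ → ℂ) →ₗ[ℂ] (ι → ℂ) := Matrix.mulVecLin (Matrix.of h)
  have hfa : ∀ u s, f u s = ∑ k, u k * h s k := fun u s => by
    simp [f, Matrix.mulVec, dotProduct, mul_comm]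
  have key : ∀ u l, ∑ k, u k * ∑ s, a s * h s k * t s l = ∑ s, a s * f u s * t s l := by
    intro u l
    simp only [hfa, Finset.mul_sum, Finset.sum_mul]
    rw [Finset.sum_comm]
    exact Finset.sum_congr rfl fun s _ => Finset.sum_congr rfl fun k _ => by ring
  have hfi : Function.Injective f := by
    rw [← LinearMap.ker_eq_bot, LinearMap.ker_eq_bot']
    intro u hu
    exact hinj u fun l => by simp [key, hu]
  -- Injective between spaces of equal dimension. A preimage of the standard basis vector `e_s`
  -- under `f` will detect both the coefficient of `h s` in a relation and the vanishing of `a s`.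
  have hfs : Function.Surjective f :=
    (LinearMap.injective_iff_surjective_of_finrank_eq_finrank (by simpa using hcard.symm)).1 hfi
  constructor
  · rw [Fintype.linearIndependent_iff]
    intro g hg s
    obtain ⟨u, hu⟩ := hfs (Pi.single s 1)
    have h1 : ∑ s', g s' * f u s' = 0 := by
      simp only [hfa, Finset.mul_sum]
      rw [Finset.sum_comm]
      refine Finset.sum_eq_zero fun k _ => ?_
      have := congrFun hg k
      simp only [Finset.sum_apply, Pi.smul_apply, smul_eq_mul, Pi.zero_apply] at this
      calc ∑ s', g s' * (u k * h s' k) = u k * ∑ s', g s' * h s' k := by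
            rw [Finset.mul_sum]
            exact Finset.sum_congr rfl fun s _ => by ring
        _ = 0 := by rw [this, mul_zero]
    simpa [hu, Pi.single_apply] using h1
  · intro s hs
    obtain ⟨u, hu⟩ := hfs (Pi.single s 1)
    have h1 : u = 0 := hinj u fun l => by
      rw [key, hu]
      refine Finset.sum_eq_zero fun s' _ => ?_
      by_cases hss : s' = s
      · subst hss; simp [hs]
      · simp [hss]
    rw [h1, map_zero] at hu
    simpa using congrFun hu s

/-- The `h s` form a basis, so a linear functional may take any prescribed values on them. These
values make each `h s` a common eigenvector of all the `N_j`, with eigenvalue `t s j / a s`. -/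
theorem exists_generating [DecidableEq κ] (hcard : Fintype.card ι = Fintype.card κ) (a : ι → ℂ)
    {h : ι → κ → ℂ} (t : ι → T → ℂ) (hh : LinearIndependent ℂ h) :
    ∃ G : κ → κ → T → ℂ, ∀ i j s, ∑ k, G k i j * h s k = t s j / a s * h s i := by
  choose u hu using fun (i : κ) (j : T) =>
    exists_dot_eq hcard hh fun s => t s j / a s * h s i
  exact ⟨fun k i j => u i j k, hu⟩

/-- The `hₛ` are eigenvectors of the matrices formed from a generating matrix. -/
theorem mulVec_eq_of_generating {ι : Type} [Fintype T] (ξ : T → ℂ) {G : κ → κ → T → ℂ} {a : ι → ℂ}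
    {h : ι → κ → ℂ} {t : ι → T → ℂ}
    (hG : ∀ i j s, ∑ k, G k i j * h s k = t s j / a s * h s i) (s : ι) :
    (Matrix.of fun i k => ∑ j, ξ j * G k i j).mulVec (h s)
      = (∑ j, ξ j * (t s j / a s)) • h s := by
  ext i
  simp only [Matrix.mulVec, dotProduct, Matrix.of_apply, Pi.smul_apply, smul_eq_mul,
    Finset.sum_mul]
  rw [Finset.sum_comm]
  refine Finset.sum_congr rfl fun j _ => ?_
  rw [mul_assoc, ← hG, Finset.mul_sum]
  exact Finset.sum_congr rfl fun k _ => by ring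

/-- The matrix factors through `u ↦ (∑ k, u k * h s k)_s`: independence of the `t s` and `a s ≠ 0`
force these numbers to vanish, and the `h s` span. -/
theorem coeff_injective [DecidableEq κ] (hcard : Fintype.card ι = Fintype.card κ) {a : ι → ℂ}
    {h : ι → κ → ℂ} {t : ι → T → ℂ} (hh : LinearIndependent ℂ h) (ha : ∀ s, a s ≠ 0)
    (ht : LinearIndependent ℂ t) (u : κ → ℂ)
    (hu : ∀ l, ∑ k, u k * ∑ s, a s * h s k * t s l = 0) : u = 0 := by
  refine eq_zero_of_dot_eq_zero hcard hh fun s => ?_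
  rw [Fintype.linearIndependent_iff] at ht
  have h1 := ht (fun s => a s * ∑ k, u k * h s k) (by
    ext l
    rw [Pi.zero_apply, ← hu l]
    simp only [Finset.sum_apply, Pi.smul_apply, smul_eq_mul, Finset.mul_sum, Finset.sum_mul]
    rw [Finset.sum_comm]
    exact Finset.sum_congr rfl fun s _ => Finset.sum_congr rfl fun k _ => by ring) s
  exact (mul_eq_zero.1 h1).resolve_left (ha s)

theorem indep_of_restrict_indep {ι T : Type} {j : T} {t : ι → T → ℂ}
    (ht : LinearIndependent ℂ (fun s (l : {l // l ≠ j}) => t s l)) : LinearIndependent ℂ t := by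
  refine LinearIndependent.of_comp (LinearMap.funLeft ℂ ℂ (Subtype.val : {l // l ≠ j} → T)) ?_
  exact ht

variable {X : Type} {l : Filter X} {η : X → ℝ}

/-- The principal cube root `z` of `a³ / a₀³` is near `1`, as it is differentiable there. Then `τ =
z a₀ / a` is a cube root of unity and `τ a = z a₀`. -/
theorem exists_cube_root_near (hη : Tendsto η l (𝓝 0)) {a : X → ℂ} {a₀ : ℂ} (ha₀ : a₀ ≠ 0)
    (h : Near l η (fun x => a x ^ 3) (a₀ ^ 3)) :
    ∃ τ : X → ℂ, (∀ x, τ x ^ 3 = 1) ∧ Near l η (fun x => τ x * a x) a₀ := by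
  classical
  have h1 : Near l η (fun x => (a x ^ 3 / a₀ ^ 3) ^ (1 / 3 : ℂ)) 1 := by
    have h2 : Near l η (fun x => a x ^ 3 / a₀ ^ 3) 1 := by
      have := h.div hη (Near.const (a₀ ^ 3)) (pow_ne_zero 3 ha₀)
      rwa [div_self (pow_ne_zero 3 ha₀)] at this
    have h3 : DifferentiableAt ℂ (fun z : ℂ => z ^ (1 / 3 : ℂ)) 1 :=
      DifferentiableAt.cpow differentiableAt_id (differentiableAt_const _)
        (by simp [Complex.one_mem_slitPlane])
    have h4 := h2.comp_differentiableAt hη h3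
    rwa [Complex.one_cpow] at h4
  have hne : ∀ᶠ x in l, a x ≠ 0 := by
    filter_upwards [h.eventually_ne hη (pow_ne_zero 3 ha₀)] with x hx h0
    exact hx (by simp [h0])
  set z : X → ℂ := fun x => (a x ^ 3 / a₀ ^ 3) ^ (1 / 3 : ℂ) with hz
  have hz3 : ∀ x, z x ^ 3 = a x ^ 3 / a₀ ^ 3 := fun x => by
    have := Complex.cpow_nat_inv_pow (a x ^ 3 / a₀ ^ 3) (n := 3) (by norm_num)
    rw [← this]
    simp [hz]
  have hτ : ∀ᶠ x in l, (z x * a₀ / a x) ^ 3 = 1 := by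
    filter_upwards [hne] with x hx
    rw [div_pow, mul_pow, hz3]
    field_simp
  refine ⟨fun x => if (z x * a₀ / a x) ^ 3 = 1 then z x * a₀ / a x else 1, fun x => ?_, ?_⟩
  · dsimp only
    split_ifs with hx
    · exact hx
    · norm_num
  · have h4 := h1.const_mul a₀
    rw [mul_one] at h4
    refine h4.congr' ?_
    filter_upwards [hne, hτ] with x hx hx'
    rw [if_pos hx']
    field_simp

/-- Every unknown is found by a well-conditioned linear problem or a simple eigenproblem, in the
order `G`, `h` up to scale, `t / a`, the scales, `a³`; none of these steps loses the rate. -/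
theorem near_blocks [Fintype T] [DecidableEq ι] [DecidableEq κ] [DecidableEq T] [Nonempty T]
    (hη : Tendsto η l (𝓝 0)) (hcard : Fintype.card ι = Fintype.card κ)
    {a₀ : ι → ℂ} {h₀ : ι → κ → ℂ} {t₀ : ι → T → ℂ} (ha₀ : ∀ s, a₀ s ≠ 0)
    (hh₀ : LinearIndependent ℂ h₀)
    (ht₀ : ∀ j : T, LinearIndependent ℂ (fun s (j' : {j' // j' ≠ j}) => t₀ s j'))
    (ξ : T → ℂ) (hξ : Function.Injective fun s => ∑ j, ξ j * (t₀ s j / a₀ s))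
    {a : X → ι → ℂ} {h : X → ι → κ → ℂ} {t : X → ι → T → ℂ}
    (S1 : ∀ k j, Near l η (fun x => ∑ s, a x s * h x s k * t x s j) (∑ s, a₀ s * h₀ s k * t₀ s j))
    (S2 : ∀ i j j', j ≠ j' → Near l η (fun x => ∑ s, h x s i * t x s j * t x s j')
      (∑ s, h₀ s i * t₀ s j * t₀ s j'))
    (S3 : ∀ j j', j ≠ j' → Near l η (fun x => ∑ s, a x s * t x s j * t x s j')
      (∑ s, a₀ s * t₀ s j * t₀ s j')) :
    ∃ (σ : X → Equiv.Perm ι) (τ : X → ι → ℂ), (∀ x k, τ x k ^ 3 = 1) ∧ ∀ k,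
      Near l η (fun x => τ x k * a x (σ x k)) (a₀ k) ∧
      (∀ i, Near l η (fun x => τ x k * h x (σ x k) i) (h₀ k i)) ∧
      ∀ j, Near l η (fun x => τ x k * t x (σ x k) j) (t₀ k j) := by
  have ht : LinearIndependent ℂ t₀ := indep_of_restrict_indep (ht₀ (Classical.arbitrary T))
  -- nondegeneracy of the nearby decompositions
  have hnd : ∀ᶠ x in l, LinearIndependent ℂ (h x) ∧ ∀ s, a x s ≠ 0 := by
    -- Nothing is assumed about the nearby decomposition itself: its matrix of entries `(0,k,j)` is
    -- close to an injective one, which forces this.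
    obtain ⟨c, hc, hlow⟩ := Near.eventually_lower_bound
      (A := fun x j k => ∑ s, a x s * h x s k * t x s j) (fun j k => (S1 k j).tendsto hη)
      (coeff_injective hcard hh₀ ha₀ ht)
    filter_upwards [hlow] with x hx
    refine indep_and_ne_zero_of_factor_injective (t := t x) hcard fun u hu => ?_
    have h1 := hx u
    have h2 : (fun j => ∑ k, u k * ∑ s, a x s * h x s k * t x s j) = 0 := funext hu
    rw [h2, norm_zero] at h1
    exact norm_le_zero_iff.1 (nonpos_of_mul_nonpos_right h1 hc)
  -- generating matrices
  obtain ⟨G₀, hG₀⟩ := exists_generating hcard a₀ t₀ hh₀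
  obtain ⟨G, hG⟩ := Filter.Eventually.exists_choice (l := l) (Y := κ → κ → T → ℂ)
    (P := fun x G => ∀ i j s, ∑ k, G k i j * h x s k = t x s j / a x s * h x s i)
    (hnd.mono fun x hx => exists_generating hcard (a x) (t x) hx.1)
  -- Pairing the generating relation with `a s * t s j'` gives a linear system with coefficients
  -- from `S1` and right-hand side from `S2`. Only `j' ≠ j` is available, hence independence of the
  -- tails with `j` removed.
  have hGn : ∀ k i j, Near l η (fun x => G x k i j) (G₀ k i j) := by
    have expand : ∀ (g : κ → ℂ) (a' : ι → ℂ) (h' : ι → κ → ℂ) (t' : ι → T → ℂ) (j' : T),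
        ∑ k, g k * ∑ s, a' s * h' s k * t' s j' = ∑ s, a' s * (∑ k, g k * h' s k) * t' s j' := by
      intro g a' h' t' j'
      simp only [Finset.mul_sum, Finset.sum_mul]
      rw [Finset.sum_comm]
      exact Finset.sum_congr rfl fun s _ => Finset.sum_congr rfl fun k _ => by ring
    intro k i j
    refine Near.solve (ι := {j' : T // j' ≠ j}) hη
      (A := fun x j' k => ∑ s, a x s * h x s k * t x s j')
      (A₀ := fun j' k => ∑ s, a₀ s * h₀ s k * t₀ s j') (fun j' k => S1 k j')
      (coeff_injective hcard hh₀ ha₀ (ht₀ j)) (u := fun x k => G x k i j)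
      (u₀ := fun k => G₀ k i j) (fun j' => ?_) k
    have h1 := S2 i j j' (Ne.symm j'.2)
    have h2 : ∑ k, G₀ k i j * ∑ s, a₀ s * h₀ s k * t₀ s j' = ∑ s, h₀ s i * t₀ s j * t₀ s j' := by
      rw [expand]
      refine Finset.sum_congr rfl fun s _ => ?_
      have := ha₀ s
      rw [hG₀]
      field_simp
    rw [h2]
    refine h1.congr' ?_
    filter_upwards [hnd, hG] with x hx hGx
    rw [expand]
    refine Finset.sum_congr rfl fun s _ => ?_
    have := hx.2 s
    rw [hGx]
    field_simp
  -- eigenvectors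
  obtain ⟨σ, c, hσ⟩ := near_eigenbasis hη hcard
    (N := fun x => Matrix.of fun i k => ∑ j, ξ j * G x k i j)
    (N₀ := Matrix.of fun i k => ∑ j, ξ j * G₀ k i j)
    (fun i k => Near.sum _ fun j _ => (hGn k i j).const_mul (ξ j)) hξ
    (mulVec_eq_of_generating ξ hG₀) hh₀ (ev := fun x s => ∑ j, ξ j * (t x s j / a x s)) (v := h)
    (hG.mono fun x hx => mulVec_eq_of_generating ξ hx) (hnd.mono fun x hx => hx.1)
  have hc : ∀ᶠ x in l, ∀ k, c x k ≠ 0 := eventually_all.2 fun k => (hσ k).1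
  set v : X → ι → κ → ℂ := fun x k i => (c x k)⁻¹ * h x (σ x k) i with hv
  have hvn : ∀ k i, Near l η (fun x => v x k i) (h₀ k i) := fun k => (hσ k).2
  set w : X → ι → T → ℂ := fun x k j => t x (σ x k) j / a x (σ x k) with hw
  -- `w k j` is the eigenvalue of `N_j` on `v k`, read off from a coordinate in which the limiting
  -- eigenvector does not vanish.
  have hwn : ∀ k j, Near l η (fun x => w x k j) (t₀ k j / a₀ k) := by
    intro k j
    obtain ⟨i, hi⟩ : ∃ i, h₀ k i ≠ 0 := Function.ne_iff.1 (hh₀.ne_zero k)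
    have h1 : Near l η (fun x => (∑ k', G x k' i j * v x k k') / v x k i)
        ((∑ k', G₀ k' i j * h₀ k k') / h₀ k i) :=
      (Near.sum _ fun k' _ => (hGn k' i j).mul hη (hvn k k')).div hη (hvn k i) hi
    rw [hG₀, mul_div_cancel_right₀ _ hi] at h1
    refine h1.congr' ?_
    filter_upwards [hG, (hvn k i).eventually_ne hη hi] with x hx hx'
    rw [div_eq_iff hx']
    have h2 := hx i j (σ x k)
    simp only [hv, hw]
    calc _ = (c x k)⁻¹ * ∑ k', G x k' i j * h x (σ x k) k' := by
          rw [Finset.mul_sum]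
          exact Finset.sum_congr rfl fun k _ => by ring
      _ = _ := by rw [h2]; ring
  have hw₀ : ∀ k, ∃ j, t₀ k j / a₀ k ≠ 0 := fun k => by
    obtain ⟨j, hj⟩ : ∃ j, t₀ k j ≠ 0 := Function.ne_iff.1 (ht.ne_zero k)
    exact ⟨j, div_ne_zero hj (ha₀ k)⟩
  -- the scalars `a² c`
  have hac : ∀ k, Near l η (fun x => a x (σ x k) ^ 2 * c x k) (a₀ k ^ 2) := by
    -- With `h = c v` and `t = a w`, the sums in `S1` become `∑ (a² c) v ⊗ w`, linear in `a² c`.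
    refine Near.solve (ι := κ × T) hη (A := fun x m k => v x k m.1 * w x k m.2)
      (A₀ := fun m k => h₀ k m.1 * (t₀ k m.2 / a₀ k))
      (fun m k => (hvn k m.1).mul hη (hwn k m.2)) (fun u hu => ?_)
      (u := fun x k => a x (σ x k) ^ 2 * c x k) (u₀ := fun k => a₀ k ^ 2) (fun m => ?_)
    · ext k
      obtain ⟨j, hj⟩ := hw₀ k
      rw [Fintype.linearIndependent_iff] at hh₀
      have := hh₀ (fun k => u k * (t₀ k j / a₀ k)) (by
        ext i
        rw [Pi.zero_apply, ← hu (i, j)]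
        simp only [Finset.sum_apply, Pi.smul_apply, smul_eq_mul]
        exact Finset.sum_congr rfl fun k _ => by ring) k
      exact (mul_eq_zero.1 this).resolve_right hj
    · have h1 := S1 m.1 m.2
      have h2 : ∑ k, a₀ k ^ 2 * (h₀ k m.1 * (t₀ k m.2 / a₀ k))
          = ∑ s, a₀ s * h₀ s m.1 * t₀ s m.2 :=
        Finset.sum_congr rfl fun k _ => by have := ha₀ k; field_simp
      rw [h2]
      refine h1.congr' ?_
      filter_upwards [hnd, hc] with x hx hcx
      rw [← Equiv.sum_comp (σ x)]
      refine Finset.sum_congr rfl fun k _ => ?_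
      have h3 := hx.2 (σ x k)
      have h4 := hcx k
      simp only [hv, hw]
      field_simp
  -- the scalars `a³`
  have haa : ∀ k, Near l η (fun x => a x (σ x k) ^ 3) (a₀ k ^ 3) := by
    -- Likewise the sums in `S3` become `∑ a³ w_j w_j'` with `j ≠ j'`. For uniqueness it suffices to
    -- fix one `j` with `w k j ≠ 0` and let `j' ≠ j` vary.
    refine Near.solve (ι := {m : T × T // m.1 ≠ m.2}) hη
      (A := fun x m k => w x k m.1.1 * w x k m.1.2)
      (A₀ := fun m k => t₀ k m.1.1 / a₀ k * (t₀ k m.1.2 / a₀ k))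
      (fun m k => (hwn k m.1.1).mul hη (hwn k m.1.2)) (fun u hu => ?_)
      (u := fun x k => a x (σ x k) ^ 3) (u₀ := fun k => a₀ k ^ 3) (fun m => ?_)
    · ext k
      obtain ⟨j, hj⟩ := hw₀ k
      have ht₁ := ht₀ j
      rw [Fintype.linearIndependent_iff] at ht₁
      have := ht₁ (fun k => u k * (t₀ k j / a₀ k) / a₀ k) (by
        ext j'
        rw [Pi.zero_apply, ← hu ⟨(j, j'), Ne.symm j'.2⟩]
        simp only [Finset.sum_apply, Pi.smul_apply, smul_eq_mul]
        exact Finset.sum_congr rfl fun k _ => by ring) k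
      have h1 := (div_eq_zero_iff.1 this).resolve_right (ha₀ k)
      exact (mul_eq_zero.1 h1).resolve_right hj
    · have h1 := S3 m.1.1 m.1.2 m.2
      have h2 : ∑ k, a₀ k ^ 3 * (t₀ k m.1.1 / a₀ k * (t₀ k m.1.2 / a₀ k))
          = ∑ s, a₀ s * t₀ s m.1.1 * t₀ s m.1.2 :=
        Finset.sum_congr rfl fun k _ => by have := ha₀ k; field_simp
      rw [h2]
      refine h1.congr' ?_
      filter_upwards [hnd] with x hx
      rw [← Equiv.sum_comp (σ x)]
      refine Finset.sum_congr rfl fun k _ => ?_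
      have h3 := hx.2 (σ x k)
      simp only [hw]
      field_simp
  choose τ hτ hτn using fun k => exists_cube_root_near hη (ha₀ k) (haa k)
  refine ⟨σ, fun x k => τ k x, fun x k => hτ k x, fun k => ⟨hτn k, fun i => ?_, fun j => ?_⟩⟩
  -- Because `τ³ = 1`, the factor `a² c / (τ a)²` equals `τ c`, so this expression is `τ h`.
  · have h1 : Near l η (fun x => a x (σ x k) ^ 2 * c x k / (τ k x * a x (σ x k)) ^ 2 * v x k i)
        (a₀ k ^ 2 / a₀ k ^ 2 * h₀ k i) := by
      refine ((hac k).div hη ?_ (pow_ne_zero 2 (ha₀ k))).mul hη (hvn k i)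
      simpa only [pow_two] using (hτn k).mul hη (hτn k)
    rw [div_self (pow_ne_zero 2 (ha₀ k)), one_mul] at h1
    refine h1.congr' ?_
    filter_upwards [hnd, hc] with x hx hcx
    have h2 := hx.2 (σ x k)
    have h3 := hcx k
    have h4 : τ k x ≠ 0 := fun h0 => by simpa [h0] using hτ k x
    simp only [hv]
    field_simp
    rw [hτ, one_mul]
  · have h1 := (hτn k).mul hη (hwn k j)
    rw [mul_div_cancel₀ _ (ha₀ k)] at h1
    refine h1.congr' ?_
    filter_upwards [hnd] with x hx
    have h2 := hx.2 (σ x k)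
    simp only [hw]
    field_simp

end Blocks

/-! ### Moments of diagonal Gaussian mixtures up to order three. -/

section GaussianMoments

variable {μ : ℝ} {v : NNReal}

theorem integrable_pow_gaussianReal (n : ℕ) : Integrable (fun x => x ^ n) (gaussianReal μ v) := by
  have h := (memLp_id_gaussianReal' (μ := μ) (v := v) n (by simp)).integrable_norm_pow'
  refine h.mono (by fun_prop) (Filter.Eventually.of_forall fun x => by simp)

theorem integral_sq_gaussianReal : ∫ x, x ^ 2 ∂gaussianReal μ v = μ ^ 2 + v := by
  have h1 : Var[id; gaussianReal μ v] = v := variance_id_gaussianReal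
  rw [variance_eq_sub (memLp_id_gaussianReal 2)] at h1
  simp only [Pi.pow_apply, id_eq, integral_id_gaussianReal] at h1
  linarith

/-- The reflection `x ↦ 2μ - x` preserves the law; expanding `(2μ - x)³` gives a linear equation for
the third moment in terms of the lower ones. -/
theorem integral_cube_gaussianReal :
    ∫ x, x ^ 3 ∂gaussianReal μ v = μ ^ 3 + 3 * μ * v := by
  have h1 : ∫ x, x ^ 3 ∂gaussianReal μ v = ∫ x, (2 * μ - x) ^ 3 ∂gaussianReal μ v := by
    have h2 := gaussianReal_map_const_sub (μ := μ) (v := v) (2 * μ)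
    rw [show 2 * μ - μ = μ by ring] at h2
    conv_lhs => rw [← h2]
    rw [integral_map (by fun_prop) (by fun_prop)]
  have i1 : Integrable (fun x => x) (gaussianReal μ v) := by
    simpa using integrable_pow_gaussianReal (μ := μ) (v := v) 1
  have i2 := integrable_pow_gaussianReal (μ := μ) (v := v) 2
  have i3 := integrable_pow_gaussianReal (μ := μ) (v := v) 3
  have h3 : ∫ x, (2 * μ - x) ^ 3 ∂gaussianReal μ v
      = 8 * μ ^ 3 - 12 * μ ^ 2 * μ + 6 * μ * (μ ^ 2 + v) - ∫ x, x ^ 3 ∂gaussianReal μ v := by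
    calc _ = ∫ x, (8 * μ ^ 3 - 12 * μ ^ 2 * x + 6 * μ * x ^ 2 - x ^ 3) ∂gaussianReal μ v := by
          congr 1; ext x; ring
      _ = _ := by
          rw [integral_sub ?_ i3, integral_add ?_ (i2.const_mul _),
            integral_sub (integrable_const _) (i1.const_mul _), integral_const_mul (12 * μ ^ 2),
            integral_const_mul (6 * μ), integral_const, integral_id_gaussianReal,
            integral_sq_gaussianReal]
          · simp
          · exact (integrable_const _).sub (i1.const_mul _)
          · exact ((integrable_const _).sub (i1.const_mul _)).add (i2.const_mul _)
  linarith

end GaussianMoments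

section ProductMoments

variable {d : ℕ} (m : Fin d → ℝ) (v : Fin d → NNReal)

/-- The exponents count how often each label occurs in `t`; in this form the integral over a product
measure factors for every pattern of coinciding labels. -/
theorem tensorCube_eq_prod (y : Fin d → ℝ) (t : Fin d × Fin d × Fin d) :
    tensorCube y t = ∏ i, y i ^ ((if i = t.1 then 1 else 0) + (if i = t.2.1 then 1 else 0)
      + (if i = t.2.2 then 1 else 0)) := by
  simp only [pow_add, Finset.prod_mul_distrib, pow_ite, pow_one, pow_zero]
  simp [tensorCube]

theorem integrable_tensorCube (t : Fin d × Fin d × Fin d) :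
    Integrable (fun y => tensorCube y t) (Measure.pi fun j => gaussianReal (m j) (v j)) := by
  simp only [tensorCube_eq_prod]
  exact Integrable.fintype_prod (f := fun i z => z ^ ((if i = t.1 then 1 else 0)
    + (if i = t.2.1 then 1 else 0) + (if i = t.2.2 then 1 else 0)))
    fun i => integrable_pow_gaussianReal _

theorem integral_tensorCube_eq_prod (t : Fin d × Fin d × Fin d) :
    ∫ y, tensorCube y t ∂(Measure.pi fun j => gaussianReal (m j) (v j))
      = ∏ i, ∫ z, z ^ ((if i = t.1 then 1 else 0) + (if i = t.2.1 then 1 else 0)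
        + (if i = t.2.2 then 1 else 0)) ∂gaussianReal (m i) (v i) := by
  simp only [tensorCube_eq_prod]
  exact integral_fintype_prod_eq_prod (fun (i : Fin d) (z : ℝ) => z ^ ((if i = t.1 then 1 else 0)
    + (if i = t.2.1 then 1 else 0) + (if i = t.2.2 then 1 else 0)))

theorem integral_tensorCube_of_ne {t : Fin d × Fin d × Fin d}
    (ht : t.1 ≠ t.2.1 ∧ t.2.1 ≠ t.2.2 ∧ t.1 ≠ t.2.2) :
    ∫ y, tensorCube y t ∂(Measure.pi fun j => gaussianReal (m j) (v j)) = tensorCube m t := by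
  rw [integral_tensorCube_eq_prod, tensorCube_eq_prod]
  refine Finset.prod_congr rfl fun i _ => ?_
  obtain ⟨h1, h2, h3⟩ := ht
  by_cases e1 : i = t.1
  · subst e1; simp [h1, h3]
  by_cases e2 : i = t.2.1
  · subst e2; simp [h2, e1]
  by_cases e3 : i = t.2.2
  · subst e3; simp [e1, e2]
  simp [e1, e2, e3]

theorem integral_tensorCube_of_pair {i j : Fin d} (hij : i ≠ j) :
    ∫ y, tensorCube y (j, i, j) ∂(Measure.pi fun j => gaussianReal (m j) (v j))
      = tensorCube m (j, i, j) + m i * v j := by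
  rw [integral_tensorCube_eq_prod]
  have : tensorCube m (j, i, j) + m i * v j
      = ∏ k, (if k = j then m j ^ 2 + v j else 1) * (if k = i then m i else 1) := by
    rw [Finset.prod_mul_distrib]
    simp [tensorCube]
    ring
  rw [this]
  refine Finset.prod_congr rfl fun k _ => ?_
  by_cases e1 : k = j
  · subst e1; simp [Ne.symm hij, integral_sq_gaussianReal]
  by_cases e2 : k = i
  · subst e2; simp [e1]
  simp [e1, e2]

theorem integral_tensorCube_diag (j : Fin d) :
    ∫ y, tensorCube y (j, j, j) ∂(Measure.pi fun j => gaussianReal (m j) (v j))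
      = tensorCube m (j, j, j) + 3 * (m j * v j) := by
  rw [integral_tensorCube_eq_prod]
  have : tensorCube m (j, j, j) + 3 * (m j * v j)
      = ∏ k, (if k = j then m j ^ 3 + 3 * m j * v j else 1) := by
    simp [tensorCube]
    ring
  rw [this]
  refine Finset.prod_congr rfl fun k _ => ?_
  by_cases e1 : k = j
  · subst e1; simp [integral_cube_gaussianReal]
  simp [e1]

end ProductMoments

namespace DiagGaussianMixture

variable {d r : ℕ} (P : DiagGaussianMixture d r)

/-- The variances, as nonnegative reals. -/
def varNN (i : Fin r) (j : Fin d) : NNReal := ⟨P.stdDev i j ^ 2, sq_nonneg _⟩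

theorem coe_varNN (i : Fin r) (j : Fin d) : (P.varNN i j : ℝ) = P.stdDev i j ^ 2 := rfl

theorem law_eq : P.law = ∑ i, ENNReal.ofReal (P.weight i) •
    Measure.pi fun j => gaussianReal (P.mean i j) (P.varNN i j) := rfl

theorem integral_law {f : (Fin d → ℝ) → ℝ}
    (hf : ∀ i, Integrable f (Measure.pi fun j =>
      gaussianReal (P.mean i j) (P.varNN i j))) :
    ∫ y, f y ∂P.law = ∑ i, P.weight i * ∫ y, f y ∂(Measure.pi fun j =>
      gaussianReal (P.mean i j) (P.varNN i j)) := by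
  rw [law_eq, integral_finsetSum_measure fun i _ => (hf i).smul_measure ENNReal.ofReal_ne_top]
  refine Finset.sum_congr rfl fun i _ => ?_
  rw [integral_smul_measure, ENNReal.toReal_ofReal (P.weight_pos i).le, smul_eq_mul]

theorem M1_apply (a : Fin d) : P.M1 a = ∑ i, P.weight i * P.mean i a := by
  rw [M1, P.integral_law fun i => integrable_eval IsGaussian.integrable_id]
  refine Finset.sum_congr rfl fun i _ => ?_
  rw [integral_eval, integral_id_gaussianReal]

theorem M3_of_ne {t : Fin d × Fin d × Fin d}
    (ht : t.1 ≠ t.2.1 ∧ t.2.1 ≠ t.2.2 ∧ t.1 ≠ t.2.2) :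
    P.M3 t = ∑ i, P.weight i * tensorCube (P.mean i) t := by
  rw [M3, P.integral_law fun i => integrable_tensorCube _ _ _]
  exact Finset.sum_congr rfl fun i _ => by rw [integral_tensorCube_of_ne _ _ ht]

theorem M3_of_pair {i j : Fin d} (hij : i ≠ j) :
    P.M3 (j, i, j) = ∑ s, P.weight s * (tensorCube (P.mean s) (j, i, j)
      + P.mean s i * P.stdDev s j ^ 2) := by
  rw [M3, P.integral_law fun i => integrable_tensorCube _ _ _]
  exact Finset.sum_congr rfl fun s _ => by rw [integral_tensorCube_of_pair _ _ hij, coe_varNN]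

theorem M3_diag (j : Fin d) :
    P.M3 (j, j, j) = ∑ s, P.weight s * (tensorCube (P.mean s) (j, j, j)
      + 3 * (P.mean s j * P.stdDev s j ^ 2)) := by
  rw [M3, P.integral_law fun i => integrable_tensorCube _ _ _]
  exact Finset.sum_congr rfl fun s _ => by rw [integral_tensorCube_diag, coe_varNN]

end DiagGaussianMixture

/-! ### Stability of incomplete tensor decompositions, and choice of the cube root. -/

section Labels

theorem card_head {d r : ℕ} (hr : r + 1 ≤ d) : Fintype.card (Head d r) = r := by
  have e : Head d r ≃ Fin r :=
    { toFun := fun k => ⟨k.1.1 - 1, by have := k.2; omega⟩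
      invFun := fun i => ⟨⟨i.1 + 1, by omega⟩, by simp⟩
      left_inv := fun k => by ext; have := k.2; simp; omega
      right_inv := fun i => by ext; simp }
  rw [Fintype.card_congr e, Fintype.card_fin]

variable {d r : ℕ} [NeZero d]

theorem label_cases (a : Fin d) : a = 0 ∨ (∃ k : Head d r, k.1 = a) ∨ ∃ l : Tail d r, l.1 = a := by
  rcases Nat.eq_zero_or_pos a.1 with h | h
  · exact Or.inl (Fin.ext (by simpa using h))
  · rcases le_or_gt a.1 r with h' | h'
    · exact Or.inr (Or.inl ⟨⟨a, h, h'⟩, rfl⟩)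
    · exact Or.inr (Or.inr ⟨⟨a, h'⟩, rfl⟩)

theorem head_ne_zero (k : Head d r) : (0 : Fin d) ≠ k.1 := fun h => by
  have := k.2.1
  rw [← h] at this
  simp at this

theorem tail_ne_zero (j : Tail d r) : (0 : Fin d) ≠ j.1 := fun h => by
  have := j.2
  rw [← h] at this
  simp at this

theorem head_ne_tail {d r : ℕ} (k : Head d r) (j : Tail d r) : k.1 ≠ j.1 := fun h => by
  have h1 := k.2.2
  have h2 := j.2
  rw [h] at h1
  omega

theorem matNxi_eq {d r : ℕ} (ξ : Tail d r → ℂ) (G : GenMatrix d r) :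
    matNxi ξ G = Matrix.of fun a k => ∑ l, ξ l * G k a l := by
  ext a k
  simp [matNxi, matN, Matrix.sum_apply]

theorem charpoly_eq_prod {ι κ : Type} [Fintype ι] [DecidableEq ι] [Fintype κ] [DecidableEq κ]
    (hcard : Fintype.card ι = Fintype.card κ) {N : Matrix κ κ ℂ} {v : ι → κ → ℂ}
    (hv : LinearIndependent ℂ v) {ev : ι → ℂ} (h : ∀ s, N.mulVec (v s) = ev s • v s) :
    N.charpoly = ∏ s, (Polynomial.X - Polynomial.C (ev s)) := by
  rcases isEmpty_or_nonempty ι with hem | hne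
  · have : IsEmpty κ := Fintype.card_eq_zero_iff.1 (by rw [← hcard, Fintype.card_eq_zero])
    simp [Matrix.charpoly]
  refine Polynomial.funext fun z => ?_
  have h1 := det_smul_one_sub_eq_prod N
    (basisOfLinearIndependentOfCardEqFinrank hv (by simpa using hcard)) ev
    (fun s => by simpa using h s) z
  rw [Matrix.eval_charpoly, Polynomial.eval_prod]
  simp only [Polynomial.eval_sub, Polynomial.eval_X, Polynomial.eval_C]
  rw [← h1]
  congr 1
  ext i j
  simp [Matrix.smul_apply, Matrix.one_apply, Matrix.diagonal_apply]

theorem DecompConditions.exists_generating (hr : 2 * r + 2 ≤ d) {p : Fin r → Fin d → ℂ}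
    {ξ : Tail d r → ℂ} (hp : DecompConditions p ξ) : ∃ G : GenMatrix d r,
      (∀ i j s, ∑ k, G k i j * p s k.1 = p s j.1 / p s 0 * p s i.1) ∧
      IsGeneratingMatrix (fun t => ∑ i, tensorCube (p i) t) G := by
  have hcard : Fintype.card (Fin r) = Fintype.card (Head d r) := by
    rw [card_head (by omega), Fintype.card_fin]
  obtain ⟨G, hG⟩ := _root_.exists_generating hcard (fun s => p s 0)
    (fun s (j : Tail d r) => p s j.1) hp.head_indep
  refine ⟨G, hG, fun i j t => ?_⟩
  simp only [tensorCube, Finset.mul_sum]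
  rw [Finset.sum_comm]
  refine Finset.sum_congr rfl fun s _ => ?_
  have h0 := hp.lead_ne_zero s
  calc _ = p s 0 * p s t * ∑ k, G k i j * p s k.1 := by
        rw [Finset.mul_sum]
        exact Finset.sum_congr rfl fun k _ => by ring
    _ = _ := by
        rw [hG]
        field_simp

/-- The heads of the `p s` are an eigenbasis of `N(ξ)`, so these numbers, with multiplicity, are the
roots of its characteristic polynomial. -/
theorem DecompConditions.eigenvalues_injective (hr : 2 * r + 2 ≤ d) {p : Fin r → Fin d → ℂ}
    {ξ : Tail d r → ℂ} (hp : DecompConditions p ξ) :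
    Function.Injective fun s => ∑ j : Tail d r, ξ j * (p s j.1 / p s 0) := by
  have hcard : Fintype.card (Fin r) = Fintype.card (Head d r) := by
    rw [card_head (by omega), Fintype.card_fin]
  obtain ⟨G, hG, hgen⟩ := hp.exists_generating hr
  have h1 := hp.eigenvalues_distinct G hgen
  rw [charpoly_eq_prod hcard hp.head_indep (fun s => by
    rw [matNxi_eq]
    exact mulVec_eq_of_generating ξ (a := fun s => p s 0) (h := fun s (k : Head d r) => p s k.1)
      (t := fun s (j : Tail d r) => p s j.1) hG s)] at h1
  set ev : Fin r → ℂ := fun s => ∑ j : Tail d r, ξ j * (p s j.1 / p s 0)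
  have h2 : ∏ s, (Polynomial.X - Polynomial.C (ev s))
      = ((Finset.univ.val.map ev).map fun a => Polynomial.X - Polynomial.C a).prod := by
    rw [Multiset.map_map]
    rfl
  rw [h2, Polynomial.roots_multiset_prod_X_sub_C] at h1
  intro i j hij
  exact Multiset.inj_on_of_nodup_map h1 i (Finset.mem_univ i) j (Finset.mem_univ j) hij

open Filter Topology Asymptotics

variable {X : Type} {l : Filter X} {η : X → ℝ}

/-- Stability of incomplete symmetric tensor decompositions. -/
theorem near_decomposition (hη : Tendsto η l (𝓝 0)) (hr : 2 * r + 2 ≤ d)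
    {p : Fin r → Fin d → ℂ} {ξ : Tail d r → ℂ} (hp : DecompConditions p ξ)
    {q : X → Fin r → Fin d → ℂ}
    (hq : ∀ t : Omega d, Near l η (fun x => ∑ k, tensorCube (q x k) t.1)
      (∑ k, tensorCube (p k) t.1)) :
    ∃ (σ : X → Equiv.Perm (Fin r)) (τ : X → Fin r → ℂ), (∀ x k, τ x k ^ 3 = 1) ∧
      ∀ k a, Near l η (fun x => τ x k * q x (σ x k) a) (p k a) := by
  have : Nonempty (Tail d r) := ⟨⟨⟨r + 1, by omega⟩, by simp⟩⟩
  obtain ⟨σ, τ, hτ, h⟩ := near_blocks hη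
    (show Fintype.card (Fin r) = Fintype.card (Head d r) by
      rw [card_head (by omega), Fintype.card_fin])
    hp.lead_ne_zero hp.head_indep (t₀ := fun s (j : Tail d r) => p s j.1) hp.tail_indep ξ
    (hp.eigenvalues_injective hr) (a := fun x s => q x s 0)
    (h := fun x s (k : Head d r) => q x s k.1) (t := fun x s (j : Tail d r) => q x s j.1)
    (fun k j => hq ⟨(0, k.1, j.1), head_ne_zero k, head_ne_tail k j, tail_ne_zero j⟩)
    (fun i j j' hj => hq ⟨(i.1, j.1, j'.1), head_ne_tail i j, fun h => hj (Subtype.ext h),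
      head_ne_tail i j'⟩)
    (fun j j' hj => hq ⟨(0, j.1, j'.1), tail_ne_zero j, fun h => hj (Subtype.ext h),
      tail_ne_zero j'⟩)
  refine ⟨σ, τ, hτ, fun k a => ?_⟩
  rcases label_cases (r := r) a with rfl | ⟨i, rfl⟩ | ⟨j, rfl⟩
  · exact (h k).1
  · exact (h k).2.1 i
  · exact (h k).2.2 j

/-- This is the gap that makes the choice of cube root stable: a cube root of unity with small
imaginary part is `1`. -/
theorem im_sq_of_cube_eq_one {z : ℂ} (hz : z ^ 3 = 1) (hz1 : z ≠ 1) : z.im ^ 2 = 3 / 4 := by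
  have h1 : z ^ 2 + z + 1 = 0 := by
    have : (z - 1) * (z ^ 2 + z + 1) = 0 := by ring_nf; rw [hz]; ring
    exact (mul_eq_zero.1 this).resolve_left (sub_ne_zero.2 hz1)
  have hre := congrArg Complex.re h1
  have him := congrArg Complex.im h1
  simp [pow_two] at hre him
  have h2 : z.im * (2 * z.re + 1) = 0 := by linarith
  rcases mul_eq_zero.1 h2 with h3 | h3
  · rw [h3] at hre
    nlinarith [sq_nonneg (z.re + 1 / 2)]
  · have : z.re = -1 / 2 := by linarith
    rw [this] at hre
    linarith

/-- Multiplication by the cube root of unity that minimizes the imaginary part recovers real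
limits. -/
theorem near_re_of_min_im {d r : ℕ} (hη : Tendsto η l (𝓝 0)) {p : Fin r → Fin d → ℝ}
    (hp : ∀ k, p k ≠ 0)
    {q : X → Fin r → Fin d → ℂ} {σ : X → Equiv.Perm (Fin r)} {τ : X → Fin r → ℂ}
    (hτ : ∀ x k, τ x k ^ 3 = 1)
    (h : ∀ k a, Near l η (fun x => τ x k * q x (σ x k) a) (p k a : ℂ))
    {z : X → Fin r → ℂ} (hz : ∀ x k, z x k ^ 3 = 1)
    (hmin : ∀ x k (u : ℂ), u ^ 3 = 1 →
      l2norm (fun a => (z x k * q x k a).im) ≤ l2norm (fun a => (u * q x k a).im)) (k a) :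
    Near l η (fun x => (z x (σ x k) * q x (σ x k) a).re) (p k a) := by
  -- With `ζ = z / τ`, the vector `z q` is asymptotically `ζ p` with `p` real. By minimality its
  -- imaginary part is no larger than that of `τ q`, hence tends to `0`; so does `Im ζ`, and `ζ` is
  -- eventually `1`.
  have hone : ∀ᶠ x in l, z x (σ x k) = τ x k := by
    obtain ⟨b, hb⟩ : ∃ b, p k b ≠ 0 := Function.ne_iff.1 (hp k)
    set ζ : X → ℂ := fun x => z x (σ x k) / τ x k with hζ
    have hτ0 : ∀ x, τ x k ≠ 0 := fun x h0 => by simpa [h0] using hτ x k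
    have hζ3 : ∀ x, ζ x ^ 3 = 1 := fun x => by simp [hζ, div_pow, hτ, hz]
    have him : Tendsto (fun x => (z x (σ x k) * q x (σ x k) b).im) l (𝓝 0) := by
      have h1 : Tendsto (fun x => l2norm (fun a => (τ x k * q x (σ x k) a).im)) l (𝓝 0) := by
        have h2 : Tendsto (fun x => (fun a => (τ x k * q x (σ x k) a).im)) l (𝓝 0) := by
          refine tendsto_pi_nhds.2 fun a => ?_
          have := ((h k a).im).tendsto hη
          simpa using this
        have h3 := (continuous_l2norm (𝕜 := ℝ) (ι := Fin d)).tendsto 0 |>.comp h2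
        have h4 : l2norm (0 : Fin d → ℝ) = 0 := by simp [l2norm]
        rwa [h4] at h3
      refine squeeze_zero_norm (fun x => ?_) h1
      exact (norm_le_l2norm (fun a => (z x (σ x k) * q x (σ x k) a).im) b).trans
        (hmin x (σ x k) (τ x k) (hτ x k))
    have hζim : Tendsto (fun x => (ζ x * (p k b : ℂ)).im) l (𝓝 0) := by
      have hd : Tendsto (fun x => ζ x * (τ x k * q x (σ x k) b - (p k b : ℂ))) l (𝓝 0) := by
        have h5 : Tendsto (fun x => ‖τ x k * q x (σ x k) b - (p k b : ℂ)‖) l (𝓝 0) :=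
          (((h k b).trans_tendsto hη)).norm.trans (by simp)
        refine squeeze_zero_norm (fun x => ?_) h5
        have h6 : ‖ζ x‖ = 1 := Complex.norm_eq_one_of_pow_eq_one (hζ3 x) (by norm_num)
        rw [norm_mul, h6, one_mul]
      have h7 := him.sub ((Complex.continuous_im.tendsto 0).comp hd)
      simp only [Complex.zero_im, sub_zero] at h7
      refine h7.congr fun x => ?_
      rw [Function.comp_apply, ← Complex.sub_im]
      congr 1
      have := hτ0 x
      simp only [hζ]
      field_simp
      ring
    have hsq : Tendsto (fun x => (ζ x).im ^ 2) l (𝓝 0) := by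
      have h8 := (hζim.div_const (p k b)).pow 2
      simp only [zero_div, ne_eq, OfNat.ofNat_ne_zero, not_false_eq_true, zero_pow] at h8
      refine h8.congr fun x => ?_
      rw [Complex.im_mul_ofReal, mul_div_cancel_right₀ _ hb]
    filter_upwards [hsq.eventually (gt_mem_nhds (show (0 : ℝ) < 3 / 4 by norm_num))] with x hx
    by_contra hne
    have h9 : ζ x ≠ 1 := fun h1 => hne ((div_eq_one_iff_eq (hτ0 x)).1 h1)
    exact absurd (im_sq_of_cube_eq_one (hζ3 x) h9) hx.ne
  have h1 := (h k a).re
  rw [Complex.ofReal_re] at h1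
  exact h1.congr' (hone.mono fun x hx => by rw [hx])

end Labels

/-! ### Stability of weights and means. -/

section WeightsMeans

open Filter Topology Asymptotics

theorem rpow_one_third_cube {w : ℝ} (hw : 0 ≤ w) : (w ^ (1 / 3 : ℝ)) ^ 3 = w := by
  rw [← Real.rpow_natCast, ← Real.rpow_mul hw]
  norm_num

theorem tensorCube_rpow_mul {d : ℕ} {w : ℝ} (hw : 0 ≤ w) (m : Fin d → ℝ)
    (t : Fin d × Fin d × Fin d) :
    tensorCube (fun a => ((w ^ (1 / 3 : ℝ) * m a : ℝ) : ℂ)) t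
      = ((w * tensorCube m t : ℝ) : ℂ) := by
  simp only [tensorCube]
  norm_cast
  conv_rhs => rw [← rpow_one_third_cube hw]
  ring

theorem tensorCube_ofReal {d : ℕ} (m : Fin d → ℝ) (t : Fin d × Fin d × Fin d) :
    tensorCube (fun a => (m a : ℂ)) t = ((tensorCube m t : ℝ) : ℂ) := by
  simp [tensorCube]

namespace DiagGaussianMixture

variable {d r : ℕ} (P : DiagGaussianMixture d r)

/-- The real vectors `ω_i^{1/3} μ_i`. -/
noncomputable def realVec (i : Fin r) (a : Fin d) : ℝ := P.weight i ^ (1 / 3 : ℝ) * P.mean i a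

theorem decompVec_apply (i : Fin r) (a : Fin d) : P.decompVec i a = (P.realVec i a : ℂ) := rfl

theorem sum_tensorCube_decompVec (t : Omega d) :
    ∑ k, tensorCube (P.decompVec k) t.1 = (P.M3 t.1 : ℂ) := by
  rw [P.M3_of_ne t.2, Complex.ofReal_sum]
  exact Finset.sum_congr rfl fun k _ => tensorCube_rpow_mul (P.weight_pos k).le _ _

variable {P} [NeZero d] {ξ : Tail d r → ℂ}

theorem realVec_ne_zero (hP : DecompConditions P.decompVec ξ) (k : Fin r) : P.realVec k ≠ 0 :=
  fun h => hP.lead_ne_zero k (by rw [decompVec_apply, h]; simp)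

theorem eq_zero_of_sum_realVec (hP : DecompConditions P.decompVec ξ) {u : Fin r → ℝ}
    (hu : ∀ a, ∑ k, u k * P.realVec k a = 0) : u = 0 := by
  have h1 := hP.head_indep
  rw [Fintype.linearIndependent_iff] at h1
  ext k
  have := h1 (fun k => (u k : ℂ)) (by
    ext i
    have h2 := congrArg (fun x : ℝ => (x : ℂ)) (hu i.1)
    simpa [decompVec_apply] using h2) k
  simpa using this

theorem eq_zero_of_sum_weight_mean (hP : DecompConditions P.decompVec ξ) {u : Fin r → ℝ}
    (hu : ∀ a, ∑ k, u k * (P.weight k * P.mean k a) = 0) : u = 0 := by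
  have hpos : ∀ k, 0 < P.weight k ^ (1 / 3 : ℝ) := fun k => Real.rpow_pos_of_pos (P.weight_pos k) _
  have h1 := eq_zero_of_sum_realVec hP (u := fun k => u k * (P.weight k ^ (1 / 3 : ℝ)) ^ 2)
    fun a => by
      rw [← hu a]
      refine Finset.sum_congr rfl fun k _ => ?_
      conv_rhs => rw [← rpow_one_third_cube (P.weight_pos k).le]
      rw [realVec]
      ring
  ext k
  exact (mul_eq_zero.1 (congrFun h1 k)).resolve_right (pow_ne_zero 2 (hpos k).ne')

variable {X : Type} {l : Filter X} {η : X → ℝ}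

/-- Stability of the estimates `Re (τ_i p_i)` of the vectors `ω_i^{1/3} μ_i`. -/
theorem near_realVec (hη : Tendsto η l (𝓝 0)) (hr : 2 * r + 2 ≤ d)
    (hP : DecompConditions P.decompVec ξ) {q : X → Fin r → Fin d → ℂ}
    (hq : ∀ t : Omega d, Near l η (fun x => ∑ k, tensorCube (q x k) t.1) (P.M3 t.1 : ℂ))
    {z : X → Fin r → ℂ} (hz : ∀ x k, z x k ^ 3 = 1)
    (hmin : ∀ x k (u : ℂ), u ^ 3 = 1 →
      l2norm (fun a => (z x k * q x k a).im) ≤ l2norm (fun a => (u * q x k a).im)) :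
    ∃ σ : X → Equiv.Perm (Fin r), ∀ k a,
      Near l η (fun x => (z x (σ x k) * q x (σ x k) a).re) (P.realVec k a) := by
  obtain ⟨σ, τ, hτ, h⟩ := near_decomposition hη hr hP (q := q) fun t => by
    rw [sum_tensorCube_decompVec]
    exact hq t
  exact ⟨σ, near_re_of_min_im hη (realVec_ne_zero hP) hτ h hz hmin⟩

/-- Stability of weights and means. -/
theorem near_weight_mean (hη : Tendsto η l (𝓝 0)) (hr : 2 * r + 2 ≤ d)
    (hP : DecompConditions P.decompVec ξ) {w : X → Fin r → ℝ} {m : X → Fin r → Fin d → ℝ}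
    (hw : ∀ x k, 0 ≤ w x k) (h1 : ∀ a, Near l η (fun x => ∑ k, w x k * m x k a) (P.M1 a))
    (h3 : ∀ t : Omega d, Near l η (fun x => ∑ k, w x k * tensorCube (m x k) t.1) (P.M3 t.1)) :
    ∃ σ : X → Equiv.Perm (Fin r), ∀ k, Near l η (fun x => w x (σ x k)) (P.weight k) ∧
      ∀ a, Near l η (fun x => m x (σ x k) a) (P.mean k a) := by
  -- Absorbing the weights leaves a plain tensor decomposition. Its vectors are real, so `1` is an
  -- optimal cube root.
  obtain ⟨σ, hσ⟩ := near_realVec hη hr hP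
    (q := fun x k a => ((w x k ^ (1 / 3 : ℝ) * m x k a : ℝ) : ℂ)) (fun t => by
      refine (h3 t).ofReal.congr' (Eventually.of_forall fun x => ?_)
      rw [Complex.ofReal_sum]
      exact Finset.sum_congr rfl fun k _ => (tensorCube_rpow_mul (hw x k) _ _).symm)
    (z := fun _ _ => 1) (fun _ _ => one_pow 3) (fun x k u _ => by
      have : l2norm (fun a : Fin d => ((1 : ℂ) * ((w x k ^ (1 / 3 : ℝ) * m x k a : ℝ) : ℂ)).im)
          = 0 := by
        simp only [one_mul, Complex.ofReal_im]
        exact norm_zero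
      rw [this]
      exact l2norm_nonneg _)
  simp only [one_mul, Complex.ofReal_re] at hσ
  -- Third moments see only `w^{1/3} m`. The first moment is `∑ w^{2/3} (w^{1/3} m)`, a linear
  -- system for `w^{2/3}`, and so separates weight from mean.
  have h23 : ∀ k, Near l η (fun x => w x (σ x k) ^ (2 / 3 : ℝ)) (P.weight k ^ (2 / 3 : ℝ)) := by
    have hsplit : ∀ v : ℝ, 0 ≤ v → v ^ (2 / 3 : ℝ) * v ^ (1 / 3 : ℝ) = v := fun v hv => by
      rw [← Real.rpow_add_of_nonneg hv (by norm_num) (by norm_num)]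
      norm_num
    refine Near.solve hη (A := fun x a k => w x (σ x k) ^ (1 / 3 : ℝ) * m x (σ x k) a)
      (A₀ := fun a k => P.realVec k a) (fun a k => hσ k a)
      (fun u hu => eq_zero_of_sum_realVec hP hu) (u := fun x k => w x (σ x k) ^ (2 / 3 : ℝ))
      (u₀ := fun k => P.weight k ^ (2 / 3 : ℝ)) fun a => ?_
    have h2 : ∑ k, P.weight k ^ (2 / 3 : ℝ) * P.realVec k a = P.M1 a := by
      rw [P.M1_apply]
      refine Finset.sum_congr rfl fun k _ => ?_
      rw [realVec, ← mul_assoc, hsplit _ (P.weight_pos k).le]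
    rw [h2]
    refine (h1 a).congr' (Eventually.of_forall fun x => ?_)
    rw [← Equiv.sum_comp (σ x)]
    refine Finset.sum_congr rfl fun k _ => ?_
    rw [← mul_assoc, hsplit _ (hw x _)]
  -- The limit is positive, so real powers are differentiable there, although `w` is only known to
  -- be nonnegative.
  have hpow : ∀ e k, Near l η (fun x => (w x (σ x k) ^ (2 / 3 : ℝ)) ^ (e : ℝ))
      ((P.weight k ^ (2 / 3 : ℝ)) ^ (e : ℝ)) := fun e k =>
    (h23 k).comp_differentiableAt (𝕜 := ℝ) hη (g := fun v => v ^ e)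
      (Real.differentiableAt_rpow_const_of_ne e (Real.rpow_pos_of_pos (P.weight_pos k) _).ne')
  refine ⟨σ, fun k => ?_⟩
  have hwk : Near l η (fun x => w x (σ x k)) (P.weight k) := by
    have h4 := hpow (3 / 2) k
    have h5 : ∀ v : ℝ, 0 ≤ v → (v ^ (2 / 3 : ℝ)) ^ (3 / 2 : ℝ) = v := fun v hv => by
      rw [← Real.rpow_mul hv]
      norm_num
    rw [h5 _ (P.weight_pos k).le] at h4
    exact h4.congr' (Eventually.of_forall fun x => h5 _ (hw x _))
  have hwc : Near l η (fun x => w x (σ x k) ^ (1 / 3 : ℝ)) (P.weight k ^ (1 / 3 : ℝ)) := by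
    have h4 := hpow (1 / 2) k
    have h5 : ∀ v : ℝ, 0 ≤ v → (v ^ (2 / 3 : ℝ)) ^ (1 / 2 : ℝ) = v ^ (1 / 3 : ℝ) := fun v hv => by
      rw [← Real.rpow_mul hv]
      norm_num
    rw [h5 _ (P.weight_pos k).le] at h4
    exact h4.congr' (Eventually.of_forall fun x => h5 _ (hw x _))
  have hpos : P.weight k ^ (1 / 3 : ℝ) ≠ 0 := (Real.rpow_pos_of_pos (P.weight_pos k) _).ne'
  refine ⟨hwk, fun a => ?_⟩
  have h6 := (hσ k a).div hη hwc hpos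
  rw [realVec, mul_div_cancel_left₀ _ hpos] at h6
  refine h6.congr' ?_
  filter_upwards [hwc.eventually_ne hη hpos] with x hx
  rw [mul_div_cancel_left₀ _ hx]

end DiagGaussianMixture

end WeightsMeans

/-! ### Least squares: comparison of residuals and existence of solutions. -/

section LeastSquares

open Filter Topology Asymptotics

theorem Near.of_l2norm_le {𝕜 ι X : Type} [RCLike 𝕜] [Fintype ι] {l : Filter X} {η : X → ℝ}
    {f b : X → ι → 𝕜} {b₀ : ι → 𝕜} (hb : ∀ i, Near l η (fun x => b x i) (b₀ i)) {R : X → ℝ}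
    (hR : R =O[l] η) (h : ∀ᶠ x in l, l2norm (fun i => f x i - b x i) ≤ R x) (i : ι) :
    Near l η (fun x => f x i) (b₀ i) := by
  have h1 : (fun x => f x i - b x i) =O[l] η :=
    (IsBigO.of_bound 1 (h.mono fun x hx => by
      rw [one_mul]
      exact (norm_le_l2norm (fun i => f x i - b x i) i).trans
        (hx.trans (le_abs_self _)))).trans hR
  exact (h1.add (hb i)).congr_left fun x => by ring

theorem isBigO_l2norm_sub {𝕜 ι X : Type} [RCLike 𝕜] [Fintype ι] {l : Filter X} {η : X → ℝ}
    {f g : X → ι → 𝕜} {c : ι → 𝕜} (hf : ∀ i, Near l η (fun x => f x i) (c i))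
    (hg : ∀ i, Near l η (fun x => g x i) (c i)) :
    (fun x => l2norm (fun i => f x i - g x i)) =O[l] η := by
  have := isBigO_l2norm (f := fun x i => f x i - g x i) (c := fun i => c i - c i)
    fun i => (hf i).sub (hg i)
  simpa using this

theorem l2norm_sub_comm {𝕜 ι : Type} [RCLike 𝕜] [Fintype ι] (f g : ι → 𝕜) :
    l2norm (fun i => f i - g i) = l2norm (fun i => g i - f i) := by
  rw [← l2norm_neg]
  congr 1
  ext i
  simp

theorem l2norm_sub_le_add {𝕜 ι : Type} [RCLike 𝕜] [Fintype ι] (f g h : ι → 𝕜) :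
    l2norm (fun i => f i - h i) ≤ l2norm (fun i => f i - g i) + l2norm (fun i => g i - h i) := by
  refine le_trans (le_of_eq ?_) (l2norm_add_le _ _)
  congr 1
  ext i
  simp

/-- Project `c` orthogonally onto the range; no rank condition is needed. -/
theorem exists_isMinOn_l2norm_linear {𝕜 ι κ : Type} [RCLike 𝕜] [Fintype ι]
    (L : (κ → 𝕜) →ₗ[𝕜] (ι → 𝕜)) (c : ι → 𝕜) :
    ∃ u, IsMinOn (fun u => l2norm (L u - c) ^ 2) Set.univ u := by
  let L' : (κ → 𝕜) →ₗ[𝕜] EuclideanSpace 𝕜 ι :=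
    (WithLp.linearEquiv 2 𝕜 (ι → 𝕜)).symm.toLinearMap ∘ₗ L
  have hcomp : IsComplete (LinearMap.range L' : Set (EuclideanSpace 𝕜 ι)) :=
    Submodule.complete_of_finiteDimensional _
  obtain ⟨v, ⟨u, rfl⟩, hu⟩ := Submodule.exists_norm_eq_iInf_of_complete_subspace
    (LinearMap.range L') hcomp (WithLp.toLp 2 c)
  have hn : ∀ u, l2norm (L u - c) = ‖WithLp.toLp 2 c - L' u‖ := fun u => by
    rw [l2norm, norm_sub_rev]
    rfl
  refine ⟨u, fun u' _ => ?_⟩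
  rw [Set.mem_ofPred_eq]
  refine pow_le_pow_left₀ (l2norm_nonneg _) ?_ 2
  rw [hn, hn, hu]
  exact ciInf_le (f := fun w : LinearMap.range L' => ‖WithLp.toLp 2 c - (w : EuclideanSpace 𝕜 ι)‖)
    ⟨0, by rintro _ ⟨w, rfl⟩; exact norm_nonneg _⟩ ⟨L' u', u', rfl⟩

theorem exists_isMinOn_l2norm_sum {𝕜 ι κ : Type} [RCLike 𝕜] [Fintype ι] [Fintype κ]
    (A : ι → κ → 𝕜) (c : ι → 𝕜) :
    ∃ u : κ → 𝕜, IsMinOn (fun u => l2norm (fun t => c t - ∑ k, u k * A t k) ^ 2) Set.univ u := by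
  obtain ⟨u, hu⟩ := exists_isMinOn_l2norm_linear (Matrix.mulVecLin (Matrix.of A)) c
  have e : (fun u : κ → 𝕜 => l2norm (fun t => c t - ∑ k, u k * A t k) ^ 2)
      = fun u => l2norm (Matrix.mulVecLin (Matrix.of A) u - c) ^ 2 := by
    ext u
    rw [l2norm_sub_comm]
    congr 2
    ext t
    simp [Matrix.mulVec, dotProduct, mul_comm]
  exact ⟨u, by rwa [e]⟩

/-- Nonnegative least squares problems of full column rank have solutions. -/
theorem exists_isMinOn_nonneg {ι κ : Type} [Fintype ι] [Fintype κ] (A : ι → κ → ℝ) (b : ι → ℝ)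
    {c : ℝ} (hc : 0 < c) (hA : ∀ u : κ → ℝ, c * ‖u‖ ≤ ‖fun i => ∑ k, u k * A i k‖) :
    ∃ u : κ → ℝ, (∀ k, 0 ≤ u k) ∧
      IsMinOn (fun u => l2norm (fun i => b i - ∑ k, u k * A i k) ^ 2) {u | ∀ k, 0 ≤ u k} u := by
  have hcont : Continuous fun u : κ → ℝ => l2norm (fun i => b i - ∑ k, u k * A i k) ^ 2 :=
    (continuous_l2norm.comp (by fun_prop)).pow 2
  have hclosed : IsClosed {u : κ → ℝ | ∀ k, 0 ≤ u k} := by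
    simp only [Set.ofPred_forall]
    exact isClosed_iInter fun k => isClosed_le continuous_const (continuous_apply k)
  obtain ⟨u, hu, hmin⟩ := hcont.continuousOn.exists_isMinOn' hclosed (x₀ := 0)
    (fun k => le_rfl) (by
      refine Filter.Eventually.filter_mono inf_le_left ?_
      -- Outside this ball `‖A u‖ > 2 ‖b‖`, so the residual exceeds `‖b‖`, its value at `u = 0`.
      filter_upwards [(isCompact_closedBall (0 : κ → ℝ) (2 * l2norm b / c)).compl_mem_cocompact]
        with u hu
      rw [Set.mem_compl_iff, mem_closedBall_zero_iff, not_le, div_lt_iff₀ hc] at hu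
      refine pow_le_pow_left₀ (l2norm_nonneg _) ?_ 2
      have h1 := (hA u).trans (pi_norm_le_l2norm _)
      have h2 := l2norm_sub_le_add (fun i => ∑ k, u k * A i k) b (fun _ => 0)
      rw [l2norm_sub_comm _ b] at h2
      simp only [sub_zero] at h2
      simp only [Pi.zero_apply, zero_mul, Finset.sum_const_zero, sub_zero]
      have h3 : l2norm (fun i => b i) = l2norm b := rfl
      linarith)
  exact ⟨u, hu, hmin⟩

end LeastSquares

/-! ### Existence of eigenbases near a matrix with simple spectrum. -/

section Eigenbases

open Filter Topology Asymptotics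

theorem pow_card_le_norm_prod {ρ : ℝ} (hρ : 0 < ρ) (z : ℂ) (s : Multiset ℂ)
    (h : ∀ a ∈ s, ρ ≤ ‖z - a‖) : ρ ^ s.card ≤ ‖(s.map fun a => z - a).prod‖ := by
  induction s using Multiset.induction_on with
  | empty => simp
  | cons a s ih =>
    rw [Multiset.card_cons, Multiset.map_cons, Multiset.prod_cons, norm_mul, pow_succ, mul_comm]
    exact mul_le_mul (h a (Multiset.mem_cons_self _ _))
      (ih fun b hb => h b (Multiset.mem_cons_of_mem hb)) (by positivity) (norm_nonneg _)

/-- `det (z - N)` is the product of `z - a` over the roots `a` of the characteristic polynomial,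
counted with multiplicity; diagonalizability is not yet available here. -/
theorem exists_eigenvalue_near {κ : Type} [Fintype κ] [DecidableEq κ] (N : Matrix κ κ ℂ) {ρ : ℝ}
    (hρ : 0 < ρ) (z : ℂ)
    (h : ‖(z • (1 : Matrix κ κ ℂ) - N).det‖ < ρ ^ Fintype.card κ) :
    ∃ a, Module.End.HasEigenvalue (Matrix.toLin' N) a ∧ ‖z - a‖ < ρ := by
  have hsplit : N.charpoly.Splits := IsAlgClosed.splits _
  by_contra! hcon
  refine absurd h (not_lt.2 ?_)
  have h1 := pow_card_le_norm_prod hρ z N.charpoly.roots fun a ha => by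
    refine hcon a ?_
    rw [Module.End.hasEigenvalue_iff_isRoot_charpoly, Matrix.charpoly_toLin']
    exact Polynomial.isRoot_of_mem_roots ha
  have h2 : N.charpoly.roots.card = Fintype.card κ := by
    rw [← hsplit.natDegree_eq_card_roots, Matrix.charpoly_natDegree_eq_dim]
  have h3 : (z • (1 : Matrix κ κ ℂ) - N).det = (N.charpoly.roots.map fun a => z - a).prod := by
    rw [← hsplit.eval_eq_prod_roots_of_monic (Matrix.charpoly_monic N), Matrix.eval_charpoly]
    congr 1
    ext i j
    simp [Matrix.smul_apply, Matrix.one_apply, Matrix.diagonal_apply]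
  rwa [h2, ← h3] at h1

/-- Having a basis of eigenvectors for distinct eigenvalues is an open condition. -/
theorem eventually_exists_eigenbasis {X ι κ : Type} [Fintype ι] [Fintype κ]
    [DecidableEq κ] {l : Filter X} {N : X → Matrix κ κ ℂ} {N₀ : Matrix κ κ ℂ}
    (hN : Tendsto N l (𝓝 N₀)) {ev₀ : ι → ℂ} (hev₀ : Function.Injective ev₀) {v₀ : ι → κ → ℂ}
    (hv₀ : ∀ k, N₀.mulVec (v₀ k) = ev₀ k • v₀ k) (hne₀ : ∀ k, v₀ k ≠ 0) :
    ∀ᶠ x in l, ∃ (ev : ι → ℂ) (v : ι → κ → ℂ), (∀ k, l2norm (v k) = 1) ∧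
      (∀ k, Module.End.HasEigenvector (Matrix.toLin' (N x)) (ev k) (v k)) ∧
      LinearIndependent ℂ v := by
  obtain ⟨g, hg, hgap⟩ := exists_gap hev₀
  have hpos : (0 : ℝ) < (g / 2) ^ Fintype.card κ := by positivity
  have hdet : ∀ k, ∀ᶠ x in l,
      ‖(ev₀ k • (1 : Matrix κ κ ℂ) - N x).det‖ < (g / 2) ^ Fintype.card κ := fun k => by
    have hc : Continuous fun M : Matrix κ κ ℂ => ‖(ev₀ k • (1 : Matrix κ κ ℂ) - M).det‖ :=
      (Continuous.matrix_det (continuous_const.sub continuous_id)).norm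
    have h2 := (hc.tendsto N₀).comp hN
    have h3 : (ev₀ k • (1 : Matrix κ κ ℂ) - N₀).det = 0 := by
      rw [← Matrix.exists_mulVec_eq_zero_iff]
      refine ⟨v₀ k, hne₀ k, ?_⟩
      rw [Matrix.sub_mulVec, hv₀, Matrix.smul_mulVec, Matrix.one_mulVec, sub_self]
    rw [h3, norm_zero] at h2
    exact h2.eventually (gt_mem_nhds hpos)
  filter_upwards [eventually_all.2 hdet] with x hx
  choose ev hev hclose using fun k => exists_eigenvalue_near (N x) (half_pos hg) (ev₀ k) (hx k)
  have hinj : Function.Injective ev := by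
    intro i j hij
    by_contra hne
    have h1 := hgap i j hne
    have h2 := norm_sub_le (ev₀ i - ev i) (ev₀ j - ev j)
    rw [hij, sub_sub_sub_cancel_right] at h2
    have h3 := hclose i
    have h4 := hclose j
    rw [hij] at h3
    linarith
  choose u hu using fun k => (hev k).exists_hasEigenvector
  have hnorm : ∀ k, l2norm (u k) ≠ 0 := fun k h0 =>
    (hu k).2 (norm_le_zero_iff.1 ((pi_norm_le_l2norm _).trans h0.le))
  have hvec : ∀ k, Module.End.HasEigenvector (Matrix.toLin' (N x)) (ev k)
      (((l2norm (u k))⁻¹ : ℂ) • u k) := fun k =>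
    ⟨Submodule.smul_mem _ _ (hu k).1,
      smul_ne_zero (inv_ne_zero (Complex.ofReal_ne_zero.2 (hnorm k))) (hu k).2⟩
  refine ⟨ev, fun k => ((l2norm (u k))⁻¹ : ℂ) • u k, fun k => ?_, hvec,
    Module.End.eigenvectors_linearIndependent' _ ev hinj _ hvec⟩
  have h1 := hnorm k
  rw [l2norm, WithLp.toLp_smul, norm_smul, norm_inv, Complex.norm_real,
    Real.norm_of_nonneg (l2norm_nonneg _)]
  exact inv_mul_cancel₀ h1

end Eigenbases

/-! ### The tensor approximation step: existence and residual of its minimizers. -/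

section Existence

open Filter Topology Asymptotics

/-- This turns asymptotic statements into statements with a uniform `δ`. -/
theorem eventually_comap_nhds_zero {X : Type} {f : X → ℝ} (hf : ∀ x, 0 ≤ f x) {p : X → Prop} :
    (∀ᶠ x in comap f (𝓝 0), p x) ↔ ∃ δ > 0, ∀ x, f x < δ → p x := by
  rw [(Metric.nhds_basis_ball.comap f).eventually_iff]
  simp only [Set.mem_preimage, Metric.mem_ball, dist_zero_right, Real.norm_of_nonneg (hf _)]

variable {d r : ℕ} [NeZero d]

/-- Nearly optimal decompositions are bounded. -/
theorem exists_bound_of_near_decomposition (hr : 2 * r + 2 ≤ d) {p : Fin r → Fin d → ℂ}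
    {ξ : Tail d r → ℂ} (hp : DecompConditions p ξ) : ∃ δ > 0, ∃ B, ∀ q : Fin r → Fin d → ℂ,
      l2norm (fun t : Omega d => ∑ k, tensorCube (q k) t.1 - ∑ k, tensorCube (p k) t.1) < δ →
        ‖q‖ ≤ B := by
  -- The stability theorem is applied with the space of all candidates `q` as index type and the
  -- residual as rate. Permutations and cube roots of unity do not change the sup norm.
  set f : (Fin r → Fin d → ℂ) → ℝ := fun q =>
    l2norm (fun t : Omega d => ∑ k, tensorCube (q k) t.1 - ∑ k, tensorCube (p k) t.1)
  have hη : Tendsto f (comap f (𝓝 0)) (𝓝 0) := tendsto_comap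
  obtain ⟨σ, τ, hτ, h⟩ := near_decomposition hη hr hp (q := fun q => q) fun t =>
    Near.of_norm_sub_le' (isBigO_refl f _) (Eventually.of_forall fun q =>
      norm_le_l2norm (fun t : Omega d => ∑ k, tensorCube (q k) t.1 - ∑ k, tensorCube (p k) t.1) t)
  have hb : ∀ᶠ q in comap f (𝓝 0), ∀ k a, ‖τ q k * q (σ q k) a‖ < ‖p‖ + 1 :=
    eventually_all.2 fun k => eventually_all.2 fun a =>
      (((h k a).tendsto hη).norm).eventually (gt_mem_nhds
        (((norm_le_pi_norm (p k) a).trans (norm_le_pi_norm p k)).trans_lt (lt_add_one _)))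
  obtain ⟨δ, hδ, hb⟩ := (eventually_comap_nhds_zero fun q => l2norm_nonneg _).1 hb
  refine ⟨δ, hδ, ‖p‖ + 1, fun q hq => ?_⟩
  have hB : (0 : ℝ) ≤ ‖p‖ + 1 := by positivity
  refine (pi_norm_le_iff_of_nonneg hB).2 fun s => (pi_norm_le_iff_of_nonneg hB).2 fun a => ?_
  have h1 := hb q hq ((σ q).symm s) a
  rw [norm_mul, Complex.norm_eq_one_of_pow_eq_one (hτ q _) (by norm_num), one_mul,
    Equiv.apply_symm_apply] at h1
  exact h1.le

/-- A far away `q` misses the tensor of `p` by at least `δ`, hence misses `F` by more than `δ / 2`,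
which exceeds the residual of `p`. So the minimum may be sought in a ball. -/
theorem exists_isMinOn_tensor (hr : 2 * r + 2 ≤ d) {p : Fin r → Fin d → ℂ}
    {ξ : Tail d r → ℂ} (hp : DecompConditions p ξ) : ∃ δ > 0, ∀ F : Tensor3 ℂ d,
      l2norm (fun t : Omega d => ∑ k, tensorCube (p k) t.1 - F t.1) < δ →
        ∃ q, IsMinOn (fun q : Fin r → Fin d → ℂ =>
          l2norm (fun t : Omega d => ∑ k, tensorCube (q k) t.1 - F t.1) ^ 2) Set.univ q := by
  obtain ⟨δ, hδ, B, hB⟩ := exists_bound_of_near_decomposition hr hp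
  refine ⟨δ / 2, half_pos hδ, fun F hF => ?_⟩
  have hcont : Continuous fun q : Fin r → Fin d → ℂ =>
      l2norm (fun t : Omega d => ∑ k, tensorCube (q k) t.1 - F t.1) ^ 2 := by
    refine (continuous_l2norm.comp ?_).pow 2
    simp only [tensorCube]
    fun_prop
  obtain ⟨q, -, hq⟩ := hcont.continuousOn.exists_isMinOn' isClosed_univ (x₀ := p)
    (Set.mem_univ _) (by
      refine Filter.Eventually.filter_mono inf_le_left ?_
      filter_upwards [(isCompact_closedBall (0 : Fin r → Fin d → ℂ) B).compl_mem_cocompact]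
        with q hq
      rw [Set.mem_compl_iff, mem_closedBall_zero_iff, not_le] at hq
      refine pow_le_pow_left₀ (l2norm_nonneg _) ?_ 2
      have h1 : δ ≤ _ := le_of_not_gt fun h => absurd (hB q h) (not_le.2 hq)
      have h2 := l2norm_sub_le_add (fun t : Omega d => ∑ k, tensorCube (q k) t.1)
        (fun t => F t.1) (fun t => ∑ k, tensorCube (p k) t.1)
      rw [l2norm_sub_comm (fun t : Omega d => F t.1)] at h2
      linarith)
  exact ⟨q, hq⟩

variable {X : Type} {l : Filter X} {η : X → ℝ}

/-- `G₀` solves the limit equations exactly, so its residual in the perturbed ones is `O(η)`, and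
the minimizer does no worse; full column rank converts residual into distance. -/
theorem near_generating (hη : Tendsto η l (𝓝 0)) (hr : 2 * r + 2 ≤ d) {p : Fin r → Fin d → ℂ}
    {ξ : Tail d r → ℂ} (hp : DecompConditions p ξ) {F : X → Tensor3 ℂ d}
    (hF : ∀ t : Omega d, Near l η (fun x => F x t.1) (∑ k, tensorCube (p k) t.1))
    {G₀ : GenMatrix d r} (hG₀ : IsGeneratingMatrix (fun t => ∑ i, tensorCube (p i) t) G₀)
    {G : X → GenMatrix d r}
    (hG : ∀ x i j, IsMinOn (fun g : Head d r → ℂ =>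
      l2norm ((coeffA (F x) j).mulVec g - rhsB (F x) i j) ^ 2) Set.univ (fun k => G x k i j))
    (k i j) : Near l η (fun x => G x k i j) (G₀ k i j) := by
  have hA : ∀ (l' : {l' : Tail d r // l' ≠ j}) (k : Head d r),
      Near l η (fun x => coeffA (F x) j l' k) (∑ s, p s 0 * p s k.1 * p s l'.1.1) := fun l' k =>
    hF ⟨(0, k.1, l'.1.1), head_ne_zero k, head_ne_tail k l'.1, tail_ne_zero l'.1⟩
  have hb : ∀ l' : {l' : Tail d r // l' ≠ j},
      Near l η (fun x => rhsB (F x) i j l') (∑ s, p s i.1 * p s j.1 * p s l'.1.1) := fun l' =>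
    hF ⟨(i.1, j.1, l'.1.1), head_ne_tail i j, fun h => l'.2 (Subtype.ext h).symm,
      head_ne_tail i l'.1⟩
  have hvec : ∀ x (g : Head d r → ℂ), (fun l' => ∑ k, g k * coeffA (F x) j l' k - rhsB (F x) i j l')
      = (coeffA (F x) j).mulVec g - rhsB (F x) i j := fun x g => by
    ext l'
    rw [Pi.sub_apply, Matrix.mulVec, dotProduct]
    simp only [mul_comm]
  have h₀ : ∀ l' : {l' : Tail d r // l' ≠ j}, ∑ k, G₀ k i j * ∑ s, p s 0 * p s k.1 * p s l'.1.1
      = ∑ s, p s i.1 * p s j.1 * p s l'.1.1 := fun l' => hG₀ i j l'.1.1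
  refine Near.solve hη hA (coeff_injective (by rw [card_head (by omega), Fintype.card_fin])
    hp.head_indep hp.lead_ne_zero (hp.tail_indep j)) (u := fun x k => G x k i j)
    (u₀ := fun k => G₀ k i j) (fun l' => ?_) k
  rw [h₀]
  have hR := isBigO_l2norm_sub (fun l' => by
    have := Near.sum Finset.univ fun k _ => (hA l' k).const_mul (G₀ k i j)
    rwa [h₀] at this) hb
  have := Near.of_l2norm_le (f := fun x l' => ∑ k, G x k i j * coeffA (F x) j l' k) hb hR
    (Eventually.of_forall fun x => by
      have h1 := hG x i j (Set.mem_univ fun k => G₀ k i j)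
      rw [Set.mem_ofPred_eq] at h1
      have h2 := le_of_sq_le_sq h1 (l2norm_nonneg _)
      rwa [← hvec x fun k => G x k i j, ← hvec x fun k => G₀ k i j] at h2)
  exact this l'

theorem tendsto_matNxi {d r : ℕ} {ξ : Tail d r → ℂ} {G : X → GenMatrix d r} {G₀ : GenMatrix d r}
    (h : ∀ k i j, Tendsto (fun x => G x k i j) l (𝓝 (G₀ k i j))) :
    Tendsto (fun x => matNxi ξ (G x)) l (𝓝 (matNxi ξ G₀)) := by
  simp only [matNxi_eq]
  refine tendsto_pi_nhds.2 fun a => tendsto_pi_nhds.2 fun k => ?_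
  simp only [Matrix.of_apply]
  exact tendsto_finsetSum _ fun j _ => Tendsto.const_mul _ (h k a j)

theorem matNxi_mulVec {ξ : Tail d r → ℂ} {p : Fin r → Fin d → ℂ} {G : GenMatrix d r}
    (hG : ∀ i j s, ∑ k, G k i j * p s k.1 = p s j.1 / p s 0 * p s i.1) (s : Fin r) :
    (matNxi ξ G).mulVec (fun k : Head d r => p s k.1)
      = (∑ j : Tail d r, ξ j * (p s j.1 / p s 0)) • fun k : Head d r => p s k.1 := by
  rw [matNxi_eq]
  exact mulVec_eq_of_generating ξ (a := fun s => p s 0) (h := fun s (k : Head d r) => p s k.1)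
    (t := fun s (j : Tail d r) => p s j.1) hG s

/-- The remaining steps of the tensor approximation algorithm can always be carried out. -/
theorem nonempty_tensorApproxRun {F : Tensor3 ℂ d} {ξ : Tail d r → ℂ} {G : GenMatrix d r}
    (hG : ∀ i j, IsMinOn (fun g : Head d r → ℂ =>
      l2norm ((coeffA F j).mulVec g - rhsB F i j) ^ 2) Set.univ (fun k => G k i j))
    {ev : Fin r → ℂ} {v : Fin r → Head d r → ℂ} (hv1 : ∀ k, l2norm (v k) = 1)
    (hv2 : ∀ k, Module.End.HasEigenvector (Matrix.toLin' (matNxi ξ G)) (ev k) (v k))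
    (hv3 : LinearIndependent ℂ v) {q : Fin r → Fin d → ℂ}
    (hq : IsMinOn (fun q : Fin r → Fin d → ℂ =>
      l2norm (fun t : Omega d => ∑ k, tensorCube (q k) t.1 - F t.1) ^ 2) Set.univ q) :
    Nonempty (TensorApproxRun r F ξ) := by
  set w : Fin r → Tail d r → ℂ := fun k j =>
    star (v k) ⬝ᵥ (matN G j).mulVec (v k)
  obtain ⟨β, hβ⟩ := exists_isMinOn_l2norm_sum
    (fun (t : Head d r × Tail d r) (k : Fin r) => v k t.1 * w k t.2) fun t => F (0, t.1.1, t.2.1)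
  obtain ⟨θ, hθ⟩ := exists_isMinOn_l2norm_sum
    (fun (t : {t : Head d r × Head d r × Tail d r // t.1 ≠ t.2.1}) (k : Fin r) =>
      v k t.1.1 * v k t.1.2.1 * w k t.1.2.2) fun t => F (t.1.1.1, t.1.2.1.1, t.1.2.2.1)
  refine ⟨{
    G := G
    G_opt := hG
    v := v
    eigval := ev
    v_unit := hv1
    v_eig := hv2
    v_indep := hv3
    w := w
    w_eq := fun k l => rfl
    β := β
    β_opt := hβ
    θ := θ
    θ_opt := hθ
    -- Division and complex powers are total, so the starting points are defined even when some `β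
    -- k` or `θ k` vanishes.
    pInit := fun k a =>
      if ha : r < (a : ℕ) then (β k ^ 2 / θ k) ^ (1 / 3 : ℂ) * w k ⟨a, ha⟩
      else if ha' : 1 ≤ (a : ℕ) ∧ (a : ℕ) ≤ r then
        (β k ^ 2 / θ k) ^ (1 / 3 : ℂ) * (θ k / β k * v k ⟨a, ha'⟩)
      else (β k ^ 2 / θ k) ^ (1 / 3 : ℂ)
    pInit_zero := fun k => by simp
    pInit_head := fun k i => by
      rw [dif_neg (not_lt.2 i.2.2), dif_pos i.2]
    pInit_tail := fun k j => by rw [dif_pos j.2]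
    pOpt := q
    pOpt_opt := hq }⟩

/-- Only the eigenbasis and the nonlinear minimization need closeness to the limit. -/
theorem eventually_nonempty_tensorApproxRun (hη : Tendsto η l (𝓝 0)) (hr : 2 * r + 2 ≤ d)
    {p : Fin r → Fin d → ℂ} {ξ : Tail d r → ℂ} (hp : DecompConditions p ξ) {F : X → Tensor3 ℂ d}
    (hF : ∀ t : Omega d, Near l η (fun x => F x t.1) (∑ k, tensorCube (p k) t.1)) :
    ∀ᶠ x in l, Nonempty (TensorApproxRun r (F x) ξ) := by
  obtain ⟨δ, hδ, hmin⟩ := exists_isMinOn_tensor hr hp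
  have hsmall : Tendsto (fun x => l2norm fun t : Omega d => ∑ k, tensorCube (p k) t.1 - F x t.1) l
      (𝓝 0) :=
    (isBigO_l2norm_sub (f := fun _ (t : Omega d) => ∑ k, tensorCube (p k) t.1)
      (g := fun x (t : Omega d) => F x t.1) (fun t => Near.const _) hF).trans_tendsto hη
  obtain ⟨G₀, hG₀, hgen⟩ := hp.exists_generating hr
  have hex : ∀ x (i : Head d r) (j : Tail d r), ∃ g : Head d r → ℂ,
      IsMinOn (fun g : Head d r → ℂ =>
        l2norm ((coeffA (F x) j).mulVec g - rhsB (F x) i j) ^ 2) Set.univ g := fun x i j =>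
    exists_isMinOn_l2norm_linear (Matrix.mulVecLin (coeffA (F x) j)) (rhsB (F x) i j)
  choose G hG using hex
  have hN : Tendsto (fun x => matNxi ξ (fun k i j => G x i j k)) l (𝓝 (matNxi ξ G₀)) :=
    tendsto_matNxi fun k i j =>
      (near_generating hη hr hp hF hgen (G := fun x k i j => G x i j k) hG k i j).tendsto hη
  have heig := eventually_exists_eigenbasis hN (hp.eigenvalues_injective hr)
    (v₀ := fun s (k : Head d r) => p s k.1) (matNxi_mulVec hG₀) hp.head_indep.ne_zero
  filter_upwards [heig, hsmall.eventually (gt_mem_nhds hδ)] with x hx hxδ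
  obtain ⟨ev, v, hv1, hv2, hv3⟩ := hx
  obtain ⟨q, hq⟩ := hmin (F x) hxδ
  exact nonempty_tensorApproxRun (hG x) hv1 hv2 hv3 hq

/-- The exact vectors `p` compete in the minimization, and their residual is the distance from `F₀`
to `F x` on `Ω`. -/
theorem TensorApproxRun.near_pOpt {F₀ : Tensor3 ℂ d} {p : Fin r → Fin d → ℂ}
    (hp : ∀ t : Omega d, ∑ k, tensorCube (p k) t.1 = F₀ t.1) {ξ : Tail d r → ℂ}
    {F : X → Tensor3 ℂ d} (hF : ∀ t : Omega d, Near l η (fun x => F x t.1) (F₀ t.1))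
    (R : ∀ x, TensorApproxRun r (F x) ξ) (t : Omega d) :
    Near l η (fun x => ∑ k, tensorCube ((R x).pOpt k) t.1) (F₀ t.1) := by
  refine Near.of_l2norm_le (f := fun x (t : Omega d) => ∑ k, tensorCube ((R x).pOpt k) t.1) hF
    (isBigO_l2norm_sub (f := fun _ t => F₀ t.1) (fun t => Near.const _) hF)
    (Eventually.of_forall fun x => ?_) t
  have h1 := (R x).pOpt_opt (Set.mem_univ p)
  rw [Set.mem_ofPred_eq] at h1
  have h2 := le_of_sq_le_sq h1 (l2norm_nonneg _)
  simp only [hp] at h2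
  exact h2

end Existence

/-! ### Sample moments, the joint optimization, and the variances. -/

section Samples

open Filter Topology Asymptotics

theorem l2norm_comp_subtype_le {𝕜 ι : Type} [RCLike 𝕜] [Fintype ι] (p : ι → Prop)
    [DecidablePred p] (f : ι → 𝕜) : l2norm (fun t : {t // p t} => f t.1) ≤ l2norm f := by
  refine le_of_sq_le_sq ?_ (l2norm_nonneg _)
  rw [l2norm_sq, l2norm_sq, ← Finset.sum_subtype (Finset.univ.filter p) (by simp)
    (fun t => ‖f t‖ ^ 2)]
  exact Finset.sum_le_univ_sum_of_nonneg fun t => by positivity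

/-- Lower bounds for a linear map are invariant under permutations of the coordinates. -/
theorem lower_bound_of_perm {ι κ : Type} [Fintype ι] [Fintype κ] {A : ι → κ → ℝ} {c : ℝ}
    (hc : 0 < c) (σ : Equiv.Perm κ)
    (h : ∀ u : κ → ℝ, c * ‖u‖ ≤ ‖fun i => ∑ k, u k * A i (σ k)‖) (u : κ → ℝ) :
    c * ‖u‖ ≤ ‖fun i => ∑ k, u k * A i k‖ := by
  have h1 : ‖u‖ ≤ ‖u ∘ σ‖ := (pi_norm_le_iff_of_nonneg (norm_nonneg _)).2 fun k => by
    simpa using norm_le_pi_norm (u ∘ σ) (σ.symm k)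
  refine ((mul_le_mul_of_nonneg_left h1 hc.le).trans (h (u ∘ σ))).trans (le_of_eq ?_)
  congr 1
  ext i
  exact Equiv.sum_comp σ fun k => u k * A i k

theorem exists_cube_root_min_im {d : ℕ} (q : Fin d → ℂ) : ∃ z : ℂ, z ^ 3 = 1 ∧
    ∀ u : ℂ, u ^ 3 = 1 → l2norm (fun a => (z * q a).im) ≤ l2norm (fun a => (u * q a).im) := by
  obtain ⟨z, hz, hmin⟩ := Finset.exists_min_image (Polynomial.nthRootsFinset 3 (1 : ℂ))
    (fun z => l2norm (fun a => (z * q a).im))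
    ⟨1, (Polynomial.mem_nthRootsFinset (by norm_num) _).2 (one_pow 3)⟩
  exact ⟨z, (Polynomial.mem_nthRootsFinset (by norm_num) _).1 hz, fun u hu =>
    hmin u ((Polynomial.mem_nthRootsFinset (by norm_num) _).2 hu)⟩

/-- The weights and means that are feasible in the joint optimization. -/
def feasible (d r : ℕ) : Set ((Fin r → ℝ) × (Fin r → Fin d → ℝ)) :=
  {x | (∀ i, 0 ≤ x.1 i) ∧ ∑ i, x.1 i = 1}

namespace DiagGaussianMixture

variable {d r : ℕ} (P : DiagGaussianMixture d r)

/-- The error of the sample moments of orders one and three. -/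
noncomputable def sampleError {N : ℕ} (y : Fin N → Fin d → ℝ) : ℝ :=
  max (l2norm (P.M3 - sampleM3 y)) (l2norm (P.M1 - sampleM1 y))

theorem sampleError_nonneg {N : ℕ} (y : Fin N → Fin d → ℝ) : 0 ≤ P.sampleError y :=
  (l2norm_nonneg _).trans (le_max_left _ _)

theorem mem_feasible : (P.weight, P.mean) ∈ feasible d r :=
  ⟨fun i => (P.weight_pos i).le, P.weight_sum⟩

variable {X : Type} {l : Filter X} {N : X → ℕ} {y : ∀ x, Fin (N x) → Fin d → ℝ}

theorem near_sampleM3 (t : Fin d × Fin d × Fin d) :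
    Near l (fun x => P.sampleError (y x)) (fun x => sampleM3 (y x) t) (P.M3 t) :=
  Near.of_norm_sub_le' (isBigO_refl _ _) (Eventually.of_forall fun x => by
    rw [norm_sub_rev]
    exact (norm_le_l2norm (P.M3 - sampleM3 (y x)) t).trans (le_max_left _ _))

/-- The distances of the moments of given weights and means to the moments of the mixture. -/
noncomputable def momentDist (x : (Fin r → ℝ) × (Fin r → Fin d → ℝ)) : ℝ :=
  l2norm (fun a : Fin d => ∑ i, x.1 i * x.2 i a - P.M1 a)
    + l2norm (fun t : Omega d => ∑ i, x.1 i * tensorCube (x.2 i) t.1 - P.M3 t.1)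

theorem momentDist_nonneg (x : (Fin r → ℝ) × (Fin r → Fin d → ℝ)) : 0 ≤ P.momentDist x :=
  add_nonneg (l2norm_nonneg _) (l2norm_nonneg _)

theorem momentObjective_self_le {N : ℕ} (y : Fin N → Fin d → ℝ) :
    momentObjective y (P.weight, P.mean) ≤ 2 * P.sampleError y ^ 2 := by
  have h1 : l2norm (fun a : Fin d => ∑ i, P.weight i * P.mean i a - sampleM1 y a)
      ≤ P.sampleError y := by
    refine le_trans (le_of_eq ?_) (le_max_right _ _)
    congr 1
    ext a
    rw [Pi.sub_apply, M1_apply]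
  have h2 : l2norm (fun t : Omega d => ∑ i, P.weight i * tensorCube (P.mean i) t.1
      - sampleM3 y t.1) ≤ P.sampleError y := by
    refine le_trans (le_trans (le_of_eq ?_)
      (l2norm_comp_subtype_le (fun t : Fin d × Fin d × Fin d =>
        t.1 ≠ t.2.1 ∧ t.2.1 ≠ t.2.2 ∧ t.1 ≠ t.2.2) (P.M3 - sampleM3 y))) (le_max_left _ _)
    congr 1
    ext t
    rw [Pi.sub_apply, P.M3_of_ne t.2]
  have h3 := pow_le_pow_left₀ (l2norm_nonneg _) h1 2
  have h4 := pow_le_pow_left₀ (l2norm_nonneg _) h2 2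
  rw [momentObjective]
  linarith

theorem momentDist_le {N : ℕ} (y : Fin N → Fin d → ℝ) (x : (Fin r → ℝ) × (Fin r → Fin d → ℝ)) :
    P.momentDist x ≤ 2 * √(momentObjective y x) + 2 * P.sampleError y := by
  have h1 := l2norm_sub_le_add (fun a : Fin d => ∑ i, x.1 i * x.2 i a) (sampleM1 y) P.M1
  have h2 := l2norm_sub_le_add (fun t : Omega d => ∑ i, x.1 i * tensorCube (x.2 i) t.1)
    (fun t => sampleM3 y t.1) (fun t => P.M3 t.1)
  have h3 : l2norm (fun a => sampleM1 y a - P.M1 a) ≤ P.sampleError y := by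
    rw [l2norm_sub_comm]
    exact le_max_right _ _
  have h4 : l2norm (fun t : Omega d => sampleM3 y t.1 - P.M3 t.1) ≤ P.sampleError y := by
    rw [l2norm_sub_comm]
    exact (l2norm_comp_subtype_le _ (P.M3 - sampleM3 y)).trans (le_max_left _ _)
  have h5 : l2norm (fun a : Fin d => ∑ i, x.1 i * x.2 i a - sampleM1 y a)
      ≤ √(momentObjective y x) :=
    Real.le_sqrt_of_sq_le (le_add_of_nonneg_right (sq_nonneg _))
  have h6 : l2norm (fun t : Omega d => ∑ i, x.1 i * tensorCube (x.2 i) t.1 - sampleM3 y t.1)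
      ≤ √(momentObjective y x) :=
    Real.le_sqrt_of_sq_le (le_add_of_nonneg_left (sq_nonneg _))
  rw [momentDist]
  linarith

variable {P} [NeZero d] {ξ : Tail d r → ℂ}

theorem near_weight_mean_of_momentDist {η : X → ℝ} (hη : Tendsto η l (𝓝 0)) (hr : 2 * r + 2 ≤ d)
    (hP : DecompConditions P.decompVec ξ) {wm : X → (Fin r → ℝ) × (Fin r → Fin d → ℝ)}
    (hw : ∀ x k, 0 ≤ (wm x).1 k) (h : (fun x => P.momentDist (wm x)) =O[l] η) :
    ∃ σ : X → Equiv.Perm (Fin r), ∀ k, Near l η (fun x => (wm x).1 (σ x k)) (P.weight k) ∧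
      ∀ a, Near l η (fun x => (wm x).2 (σ x k) a) (P.mean k a) := by
  refine near_weight_mean hη hr hP (w := fun x => (wm x).1) (m := fun x => (wm x).2) hw
    (fun a => Near.of_norm_sub_le' h (Eventually.of_forall fun x => ?_))
    (fun t => Near.of_norm_sub_le' h (Eventually.of_forall fun x => ?_))
  · exact (norm_le_l2norm (fun a : Fin d => ∑ i, (wm x).1 i * (wm x).2 i a - P.M1 a) a).trans
      (le_add_of_nonneg_right (l2norm_nonneg _))
  · exact (norm_le_l2norm (fun t : Omega d => ∑ i, (wm x).1 i * tensorCube ((wm x).2 i) t.1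
      - P.M3 t.1) t).trans (le_add_of_nonneg_left (l2norm_nonneg _))

/-- Stability of the solutions of the joint optimization over weights and means. -/
theorem near_weight_mean_of_isMinOn (hη : Tendsto (fun x => P.sampleError (y x)) l (𝓝 0))
    (hr : 2 * r + 2 ≤ d) (hP : DecompConditions P.decompVec ξ)
    {wm : X → (Fin r → ℝ) × (Fin r → Fin d → ℝ)} (hw : ∀ x, wm x ∈ feasible d r)
    (hmin : ∀ x, IsMinOn (momentObjective (y x)) (feasible d r) (wm x)) :
    ∃ σ : X → Equiv.Perm (Fin r), ∀ k,
      Near l (fun x => P.sampleError (y x)) (fun x => (wm x).1 (σ x k)) (P.weight k) ∧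
      ∀ a, Near l (fun x => P.sampleError (y x)) (fun x => (wm x).2 (σ x k) a) (P.mean k a) := by
  refine near_weight_mean_of_momentDist hη hr hP (fun x => (hw x).1)
    -- The objective is at most `2 ε² ≤ (2ε)²`, so `momentDist_le` gives `2 · 2ε + 2ε`.
    (IsBigO.of_bound 6 (Eventually.of_forall fun x => ?_))
  have h0 := P.sampleError_nonneg (y x)
  have h1 := P.momentDist_le (y x) (wm x)
  have h2 : momentObjective (y x) (wm x) ≤ (2 * P.sampleError (y x)) ^ 2 :=
    (hmin x P.mem_feasible).trans ((P.momentObjective_self_le (y x)).trans (by nlinarith))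
  have h3 : √(momentObjective (y x) (wm x)) ≤ 2 * P.sampleError (y x) :=
    Real.sqrt_le_iff.2 ⟨by positivity, h2⟩
  rw [Real.norm_of_nonneg h0, Real.norm_of_nonneg (P.momentDist_nonneg _)]
  linarith

theorem exists_bound_of_momentDist (hr : 2 * r + 2 ≤ d) (hP : DecompConditions P.decompVec ξ) :
    ∃ δ > 0, ∃ B, ∀ wm : (Fin r → ℝ) × (Fin r → Fin d → ℝ), (∀ k, 0 ≤ wm.1 k) →
      P.momentDist wm < δ → ‖wm‖ ≤ B := by
  -- Again the candidates themselves are the index type, restricted to nonnegative weights as the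
  -- stability of weights and means requires.
  set f : {wm : (Fin r → ℝ) × (Fin r → Fin d → ℝ) // ∀ k, 0 ≤ wm.1 k} → ℝ :=
    fun wm => P.momentDist wm.1
  have hη : Tendsto f (comap f (𝓝 0)) (𝓝 0) := tendsto_comap
  obtain ⟨σ, h⟩ := near_weight_mean_of_momentDist (η := f) hη hr hP (wm := Subtype.val)
    (fun x => x.2) (isBigO_refl f _)
  set B := max ‖P.weight‖ ‖P.mean‖ + 1 with hB
  have hBw : ∀ k, ‖P.weight k‖ < B := fun k =>
    ((norm_le_pi_norm _ k).trans (le_max_left _ _)).trans_lt (lt_add_one _)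
  have hBm : ∀ k a, ‖P.mean k a‖ < B := fun k a =>
    (((norm_le_pi_norm (P.mean k) a).trans (norm_le_pi_norm _ k)).trans
      (le_max_right _ _)).trans_lt (lt_add_one _)
  have hb : ∀ᶠ x in comap f (𝓝 0), ∀ k, ‖x.1.1 (σ x k)‖ < B ∧ ∀ a, ‖x.1.2 (σ x k) a‖ < B := by
    refine eventually_all.2 fun k => ?_
    have h1 := ((h k).1.tendsto hη).norm.eventually (gt_mem_nhds (hBw k))
    have h2 := fun a => (((h k).2 a).tendsto hη).norm.eventually (gt_mem_nhds (hBm k a))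
    exact h1.and (eventually_all.2 h2)
  obtain ⟨δ, hδ, hb⟩ := (eventually_comap_nhds_zero (f := f)
    fun x => P.momentDist_nonneg x.1).1 hb
  have hB0 : 0 ≤ B := by positivity
  refine ⟨δ, hδ, B, fun wm hwm hd => ?_⟩
  have h1 := hb ⟨wm, hwm⟩ hd
  rw [Prod.norm_def, max_le_iff, pi_norm_le_iff_of_nonneg hB0, pi_norm_le_iff_of_nonneg hB0]
  refine ⟨fun s => ?_, fun s => (pi_norm_le_iff_of_nonneg hB0).2 fun a => ?_⟩
  · simpa using (h1 ((σ ⟨wm, hwm⟩).symm s)).1.le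
  · simpa using ((h1 ((σ ⟨wm, hwm⟩).symm s)).2 a).le

/-- The joint optimization over weights and means has a solution. -/
theorem exists_isMinOn_momentObjective (hr : 2 * r + 2 ≤ d)
    (hP : DecompConditions P.decompVec ξ) :
    ∃ δ > 0, ∀ (N : ℕ) (y : Fin N → Fin d → ℝ), P.sampleError y < δ →
      ∃ wm ∈ feasible d r, IsMinOn (momentObjective y) (feasible d r) wm := by
  obtain ⟨δ, hδ, B, hB⟩ := exists_bound_of_momentDist hr hP
  -- A point doing better than the true parameters has moment distance at most `6 ε < δ`, hence lies
  -- in the ball of radius `B`.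
  refine ⟨δ / 6, by positivity, fun N y hy => ?_⟩
  have hcont : Continuous (momentObjective (r := r) y) := by
    have h1 : Continuous fun x : (Fin r → ℝ) × (Fin r → Fin d → ℝ) =>
        fun a : Fin d => ∑ i, x.1 i * x.2 i a - sampleM1 y a := by fun_prop
    have h2 : Continuous fun x : (Fin r → ℝ) × (Fin r → Fin d → ℝ) =>
        fun t : Omega d => ∑ i, x.1 i * tensorCube (x.2 i) t.1 - sampleM3 y t.1 := by
      simp only [tensorCube]
      fun_prop
    exact ((continuous_l2norm.comp h1).pow 2).add ((continuous_l2norm.comp h2).pow 2)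
  have hclosed : IsClosed (feasible d r) := by
    refine IsClosed.inter (s₁ := {x : (Fin r → ℝ) × (Fin r → Fin d → ℝ) | ∀ i, 0 ≤ x.1 i})
      (s₂ := {x | ∑ i, x.1 i = 1}) ?_ (isClosed_eq (by fun_prop) continuous_const)
    simp only [Set.ofPred_forall]
    exact isClosed_iInter fun i => isClosed_le continuous_const (by fun_prop)
  obtain ⟨wm, hwm, hmin⟩ := hcont.continuousOn.exists_isMinOn' hclosed P.mem_feasible (by
    filter_upwards [mem_inf_of_left
      (isCompact_closedBall (0 : (Fin r → ℝ) × (Fin r → Fin d → ℝ)) B).compl_mem_cocompact,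
      mem_inf_of_right (mem_principal_self _)] with x hx hxS
    rw [Set.mem_compl_iff, mem_closedBall_zero_iff, not_le] at hx
    by_contra! hlt
    have h0 := P.sampleError_nonneg y
    have h1 := P.momentDist_le y x
    have h2 : momentObjective y x ≤ (2 * P.sampleError y) ^ 2 :=
      hlt.le.trans ((P.momentObjective_self_le y).trans (by nlinarith))
    have h3 : √(momentObjective y x) ≤ 2 * P.sampleError y :=
      Real.sqrt_le_iff.2 ⟨by positivity, h2⟩
    exact absurd (hB x hxS.1 (by linarith)) (not_le.2 hx))
  exact ⟨wm, hwm, hmin⟩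

/-- Stability of the vectors obtained from the tensor approximation. -/
theorem near_realVec_of_run (hη : Tendsto (fun x => P.sampleError (y x)) l (𝓝 0))
    (hr : 2 * r + 2 ≤ d) (hP : DecompConditions P.decompVec ξ)
    (R : ∀ x, TensorApproxRun r (fun t => (sampleM3 (y x) t : ℂ)) ξ) {z : X → Fin r → ℂ}
    (hz : ∀ x k, z x k ^ 3 = 1)
    (hmin : ∀ x k (u : ℂ), u ^ 3 = 1 → l2norm (fun a => (z x k * (R x).pOpt k a).im)
      ≤ l2norm (fun a => (u * (R x).pOpt k a).im)) :
    ∃ σ : X → Equiv.Perm (Fin r), ∀ k a, Near l (fun x => P.sampleError (y x))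
      (fun x => (z x (σ x k) * (R x).pOpt (σ x k) a).re) (P.realVec k a) :=
  near_realVec hη hr hP (q := fun x => (R x).pOpt)
    (TensorApproxRun.near_pOpt (F₀ := fun t => (P.M3 t : ℂ)) P.sum_tensorCube_decompVec
      (fun t => (P.near_sampleM3 t.1).ofReal) R) hz hmin

theorem tensorCube_realVec {d r : ℕ} {P : DiagGaussianMixture d r} (k : Fin r)
    (t : Fin d × Fin d × Fin d) :
    tensorCube (P.realVec k) t = P.weight k * tensorCube (P.mean k) t := by
  have := tensorCube_rpow_mul (P.weight_pos k).le (P.mean k) t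
  rw [tensorCube_ofReal] at this
  exact_mod_cast this

/-- Subtracting `∑ ω μ^{⊗3}` from `M₃` leaves only the covariance terms; the division by `3` makes
the diagonal entry fit the pattern of the others. The `q` enter through a symmetric sum, so the
limit does not depend on their numbering. -/
theorem near_aVec {d r : ℕ} {P : DiagGaussianMixture d r} {η : X → ℝ}
    (hη : Tendsto η l (𝓝 0)) {M : X → Tensor3 ℝ d}
    (hM : ∀ t, Near l η (fun x => M x t) (P.M3 t)) {q : X → Fin r → Fin d → ℝ}
    {σ : X → Equiv.Perm (Fin r)} (hq : ∀ k a, Near l η (fun x => q x (σ x k) a) (P.realVec k a))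
    (j a : Fin d) : Near l η (fun x => aVec (fun t => M x t - ∑ i, tensorCube (q x i) t) j a)
      (∑ s, P.stdDev s j ^ 2 * (P.weight s * P.mean s a)) := by
  have hA : ∀ t, Near l η (fun x => M x t - ∑ i, tensorCube (q x i) t)
      (P.M3 t - ∑ s, P.weight s * tensorCube (P.mean s) t) := fun t => by
    have h1 : Near l η (fun x => ∑ k, tensorCube (q x (σ x k)) t)
        (∑ k, tensorCube (P.realVec k) t) :=
      Near.sum _ fun k _ => ((hq k t.1).mul hη (hq k t.2.1)).mul hη (hq k t.2.2)
    simp only [tensorCube_realVec] at h1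
    exact (hM t).sub (h1.congr' (Eventually.of_forall fun x =>
      Equiv.sum_comp (σ x) fun i => tensorCube (q x i) t))
  by_cases haj : a = j
  · subst haj
    simp only [aVec, if_true]
    have h2 := (hA (a, a, a)).const_mul 3⁻¹
    rw [P.M3_diag, ← Finset.sum_sub_distrib, Finset.mul_sum] at h2
    have e : ∀ s, 3⁻¹ * (P.weight s * (tensorCube (P.mean s) (a, a, a)
        + 3 * (P.mean s a * P.stdDev s a ^ 2)) - P.weight s * tensorCube (P.mean s) (a, a, a))
        = P.stdDev s a ^ 2 * (P.weight s * P.mean s a) := fun s => by ring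
    simpa only [div_eq_inv_mul, e] using h2
  · simp only [aVec, if_neg haj]
    have h2 := hA (j, a, j)
    rw [P.M3_of_pair haj, ← Finset.sum_sub_distrib] at h2
    have e : ∀ s, P.weight s * (tensorCube (P.mean s) (j, a, j)
        + P.mean s a * P.stdDev s j ^ 2) - P.weight s * tensorCube (P.mean s) (j, a, j)
        = P.stdDev s j ^ 2 * (P.weight s * P.mean s a) := fun s => by ring
    simpa only [e] using h2

/-- Stability of the nonnegative least squares problems for the variances. -/
theorem near_variance {η : X → ℝ} (hη : Tendsto η l (𝓝 0))
    (hP : DecompConditions P.decompVec ξ) {w : X → Fin r → ℝ} {m : X → Fin r → Fin d → ℝ}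
    {σ : X → Equiv.Perm (Fin r)} (hw : ∀ k, Near l η (fun x => w x (σ x k)) (P.weight k))
    (hm : ∀ k a, Near l η (fun x => m x (σ x k) a) (P.mean k a)) {j : Fin d}
    {b : X → Fin d → ℝ}
    (hb : ∀ a, Near l η (fun x => b x a) (∑ s, P.stdDev s j ^ 2 * (P.weight s * P.mean s a)))
    {β : X → Fin r → ℝ} (hβ : ∀ x, IsMinOn (fun u : Fin r → ℝ =>
      l2norm (fun a => b x a - ∑ i, w x i * m x i a * u i) ^ 2) {u | ∀ i, 0 ≤ u i} (β x))
    (k : Fin r) : Near l η (fun x => β x (σ x k)) (P.stdDev k j ^ 2) := by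
  have hA : ∀ a k, Near l η (fun x => w x (σ x k) * m x (σ x k) a) (P.weight k * P.mean k a) :=
    fun a k => (hw k).mul hη (hm k a)
  -- The competitor is the vector of true variances, renumbered by `σ⁻¹`; being nonnegative, it is
  -- feasible.
  have hg : ∀ a, Near l η
      (fun x => ∑ i, w x i * m x i a * P.stdDev ((σ x).symm i) j ^ 2)
      (∑ s, P.stdDev s j ^ 2 * (P.weight s * P.mean s a)) := fun a => by
    refine (Near.sum Finset.univ fun k _ => (hA a k).const_mul (P.stdDev k j ^ 2)).congr'
      (Eventually.of_forall fun x => ?_)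
    rw [← Equiv.sum_comp (σ x) fun i => w x i * m x i a * P.stdDev ((σ x).symm i) j ^ 2]
    exact Finset.sum_congr rfl fun k _ => by rw [Equiv.symm_apply_apply]; ring
  refine Near.solve hη hA (fun u hu => eq_zero_of_sum_weight_mean hP hu)
    (u := fun x k => β x (σ x k)) (u₀ := fun k => P.stdDev k j ^ 2) (fun a => ?_) k
  have h1 := Near.of_l2norm_le (f := fun x a => ∑ i, w x i * m x i a * β x i) hb
    (isBigO_l2norm_sub hb hg) (Eventually.of_forall fun x => by
      have h2 := hβ x (show (fun i => P.stdDev ((σ x).symm i) j ^ 2) ∈ {u : Fin r → ℝ | ∀ i, 0 ≤ u i}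
        from fun i => sq_nonneg _)
      rw [Set.mem_ofPred_eq] at h2
      rw [l2norm_sub_comm]
      exact le_of_sq_le_sq h2 (l2norm_nonneg _)) a
  refine h1.congr' (Eventually.of_forall fun x => ?_)
  rw [← Equiv.sum_comp (σ x)]
  exact Finset.sum_congr rfl fun k _ => by ring

end DiagGaussianMixture

end Samples

/-! ### The whole algorithm: existence of runs and uniform stability. -/

section Learning

open Filter Topology Asymptotics

namespace DiagGaussianMixture

variable {d r : ℕ} [NeZero d] {P : DiagGaussianMixture d r} {ξ : Tail d r → ℂ}

theorem exists_tensorApproxRun (hr : 2 * r + 2 ≤ d) (hP : DecompConditions P.decompVec ξ) :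
    ∃ δ > 0, ∀ (N : ℕ) (y : Fin N → Fin d → ℝ), P.sampleError y < δ →
      Nonempty (TensorApproxRun r (fun t => (sampleM3 y t : ℂ)) ξ) := by
  let f : (Σ N : ℕ, Fin N → Fin d → ℝ) → ℝ := fun y => P.sampleError y.2
  have h := eventually_nonempty_tensorApproxRun (l := comap f (𝓝 0)) (η := f) tendsto_comap hr hP
    (F := fun y t => (sampleM3 y.2 t : ℂ)) fun t => by
      rw [sum_tensorCube_decompVec]
      exact (P.near_sampleM3 (y := fun y : Σ N : ℕ, Fin N → Fin d → ℝ => y.2) t.1).ofReal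
  obtain ⟨δ, hδ, h⟩ := (eventually_comap_nhds_zero (f := f)
    fun y => P.sampleError_nonneg y.2).1 h
  exact ⟨δ, hδ, fun N y hy => h ⟨N, y⟩ hy⟩

/-- The least squares problems for the first moment have full column rank. -/
theorem exists_lower_bound_q (hr : 2 * r + 2 ≤ d) (hP : DecompConditions P.decompVec ξ) :
    ∃ δ > 0, ∃ c > 0, ∀ (N : ℕ) (y : Fin N → Fin d → ℝ), P.sampleError y < δ →
      ∀ (R : TensorApproxRun r (fun t => (sampleM3 y t : ℂ)) ξ) (z : Fin r → ℂ),
        (∀ k, z k ^ 3 = 1) → (∀ k (u : ℂ), u ^ 3 = 1 →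
          l2norm (fun a => (z k * R.pOpt k a).im) ≤ l2norm (fun a => (u * R.pOpt k a).im)) →
        ∀ u : Fin r → ℝ, c * ‖u‖ ≤ ‖fun a => ∑ k, u k * (z k * R.pOpt k a).re‖ := by
  -- `δ` and `c` must not depend on the sample size, the sample, the run or the cube roots, so all
  -- of these are collected in the index type.
  let X := Σ y : (Σ N : ℕ, Fin N → Fin d → ℝ),
    {R : TensorApproxRun r (fun t => (sampleM3 y.2 t : ℂ)) ξ × (Fin r → ℂ) //
      (∀ k, R.2 k ^ 3 = 1) ∧ ∀ k (u : ℂ), u ^ 3 = 1 →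
        l2norm (fun a => (R.2 k * R.1.pOpt k a).im) ≤ l2norm (fun a => (u * R.1.pOpt k a).im)}
  let f : X → ℝ := fun x => P.sampleError x.1.2
  have hη : Tendsto f (comap f (𝓝 0)) (𝓝 0) := tendsto_comap
  obtain ⟨σ, h⟩ := near_realVec_of_run (l := comap f (𝓝 0)) (y := fun x : X => x.1.2) hη hr hP
    (fun x => x.2.1.1) (z := fun x => x.2.1.2) (fun x => x.2.2.1) (fun x => x.2.2.2)
  obtain ⟨c, hc, hlow⟩ := Near.eventually_lower_bound
    (A := fun (x : X) a k => (x.2.1.2 (σ x k) * x.2.1.1.pOpt (σ x k) a).re)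
    (A₀ := fun a k => P.realVec k a) (fun a k => (h k a).tendsto hη)
    fun u hu => eq_zero_of_sum_realVec hP hu
  obtain ⟨δ, hδ, h⟩ := (eventually_comap_nhds_zero (f := f)
    fun x => P.sampleError_nonneg x.1.2).1 hlow
  exact ⟨δ, hδ, c, hc, fun N y hy R z hz hmin =>
    lower_bound_of_perm (A := fun a k => (z k * R.pOpt k a).re) hc
      (σ ⟨⟨N, y⟩, ⟨(R, z), hz, hmin⟩⟩) (h ⟨⟨N, y⟩, ⟨(R, z), hz, hmin⟩⟩ hy)⟩

/-- The least squares problems for the variances have full column rank. -/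
theorem exists_lower_bound_weight_mean (hr : 2 * r + 2 ≤ d)
    (hP : DecompConditions P.decompVec ξ) :
    ∃ δ > 0, ∃ c > 0, ∀ (N : ℕ) (y : Fin N → Fin d → ℝ), P.sampleError y < δ →
      ∀ wm ∈ feasible d r, IsMinOn (momentObjective y) (feasible d r) wm →
        ∀ u : Fin r → ℝ, c * ‖u‖ ≤ ‖fun a => ∑ k, u k * (wm.1 k * wm.2 k a)‖ := by
  let X := Σ y : (Σ N : ℕ, Fin N → Fin d → ℝ), {wm : (Fin r → ℝ) × (Fin r → Fin d → ℝ) //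
    wm ∈ feasible d r ∧ IsMinOn (momentObjective y.2) (feasible d r) wm}
  let f : X → ℝ := fun x => P.sampleError x.1.2
  have hη : Tendsto f (comap f (𝓝 0)) (𝓝 0) := tendsto_comap
  obtain ⟨σ, h⟩ := near_weight_mean_of_isMinOn (l := comap f (𝓝 0)) (y := fun x : X => x.1.2) hη
    hr hP (wm := fun x => x.2.1) (fun x => x.2.2.1) (fun x => x.2.2.2)
  obtain ⟨c, hc, hlow⟩ := Near.eventually_lower_bound
    (A := fun (x : X) a k => x.2.1.1 (σ x k) * x.2.1.2 (σ x k) a)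
    (A₀ := fun a k => P.weight k * P.mean k a)
    (fun a k => (((h k).1.mul hη ((h k).2 a))).tendsto hη)
    fun u hu => eq_zero_of_sum_weight_mean hP hu
  obtain ⟨δ, hδ, h⟩ := (eventually_comap_nhds_zero (f := f)
    fun x => P.sampleError_nonneg x.1.2).1 hlow
  exact ⟨δ, hδ, c, hc, fun N y hy wm hwm hmin =>
    lower_bound_of_perm (A := fun a k => wm.1 k * wm.2 k a) hc
      (σ ⟨⟨N, y⟩, ⟨wm, hwm, hmin⟩⟩) (h ⟨⟨N, y⟩, ⟨wm, hwm, hmin⟩⟩ hy)⟩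

/-- The learning algorithm can be carried out. -/
theorem exists_learningRun (hr : 2 * r + 2 ≤ d) (hP : DecompConditions P.decompVec ξ) :
    ∃ δ > 0, ∀ (N : ℕ) (y : Fin N → Fin d → ℝ), P.sampleError y < δ →
      Nonempty (LearningRun r y ξ) := by
  obtain ⟨δ₁, hδ₁, h₁⟩ := exists_tensorApproxRun hr hP
  obtain ⟨δ₂, hδ₂, c₂, hc₂, h₂⟩ := exists_lower_bound_q hr hP
  obtain ⟨δ₃, hδ₃, h₃⟩ := exists_isMinOn_momentObjective hr hP
  obtain ⟨δ₄, hδ₄, c₄, hc₄, h₄⟩ := exists_lower_bound_weight_mean hr hP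
  refine ⟨min (min δ₁ δ₂) (min δ₃ δ₄), by positivity, fun N y hy => ?_⟩
  obtain ⟨⟨hy₁, hy₂⟩, hy₃, hy₄⟩ : (_ ∧ _) ∧ _ ∧ _ := by simpa only [lt_min_iff] using hy
  obtain ⟨R⟩ := h₁ N y hy₁
  choose z hz hmin using fun k => exists_cube_root_min_im (R.pOpt k)
  obtain ⟨β, hβ0, hβ⟩ := exists_isMinOn_nonneg (fun a k => (z k * R.pOpt k a).re) (sampleM1 y) hc₂
    (h₂ N y hy₂ R z hz hmin)
  obtain ⟨wm, hwm, hwmin⟩ := h₃ N y hy₃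
  choose v hv0 hv using fun j : Fin d => exists_isMinOn_nonneg (fun a k => wm.1 k * wm.2 k a)
    (aVec (fun t => sampleM3 y t - ∑ i, tensorCube (fun a => (z i * R.pOpt i a).re) t) j) hc₄
    (h₄ N y hy₄ wm hwm hwmin)
  refine ⟨{
    tensorRun := R
    τ := z
    τ_cube := hz
    τ_opt := hmin
    q := fun i a => (z i * R.pOpt i a).re
    q_eq := fun i a => rfl
    β := β
    β_nonneg := hβ0
    β_opt := hβ
    weightInit := fun i => β i ^ (3 / 2 : ℝ)
    weightInit_eq := fun i => rfl
    meanInit := fun i a => (z i * R.pOpt i a).re / (β i ^ (3 / 2 : ℝ)) ^ (1 / 3 : ℝ)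
    meanInit_eq := fun i a => rfl
    weight := wm.1
    mean := wm.2
    weight_nonneg := hwm.1
    weight_sum := hwm.2
    weight_mean_opt := hwmin
    variance := fun i j => v j i
    variance_nonneg := fun i j => hv0 j i
    variance_opt := fun j => by
      simpa only [mul_comm] using hv j
    covariance := fun i => Matrix.diagonal fun j => v j i
    covariance_eq := fun i => rfl }⟩

/-- The output of the learning algorithm depends in a Lipschitz way on the sample moments. -/
theorem learningRun_stable (hr : 2 * r + 2 ≤ d) (hP : DecompConditions P.decompVec ξ) :
    ∃ C > 0, ∃ δ > 0, ∀ (N : ℕ) (y : Fin N → Fin d → ℝ), P.sampleError y < δ →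
      ∀ R : LearningRun r y ξ, ∃ π : Equiv.Perm (Fin r), ∀ i,
        l2norm (P.mean i - R.mean (π i)) ≤ C * P.sampleError y ∧
        |P.weight i - R.weight (π i)| ≤ C * P.sampleError y ∧
        l2norm (fun t : Fin d × Fin d => P.covariance i t.1 t.2 - R.covariance (π i) t.1 t.2)
          ≤ C * P.sampleError y := by
  let X := Σ y : (Σ N : ℕ, Fin N → Fin d → ℝ), LearningRun r y.2 ξ
  let f : X → ℝ := fun x => P.sampleError x.1.2
  have hη : Tendsto f (comap f (𝓝 0)) (𝓝 0) := tendsto_comap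
  -- The numbering `ρ` of the `q̂_i` need not agree with the numbering `σ` of weights and means
  -- below; only `σ` survives in the variances.
  obtain ⟨ρ, hq⟩ := near_realVec_of_run (l := comap f (𝓝 0)) (y := fun x : X => x.1.2) hη hr hP
    (fun x => x.2.tensorRun) (z := fun x => x.2.τ) (fun x => x.2.τ_cube) (fun x => x.2.τ_opt)
  have hq' : ∀ k a, Near (comap f (𝓝 0)) f (fun x => x.2.q (ρ x k) a) (P.realVec k a) :=
    fun k a => (hq k a).congr' (Eventually.of_forall fun x => (x.2.q_eq _ _).symm)
  obtain ⟨σ, hσ⟩ := near_weight_mean_of_isMinOn (l := comap f (𝓝 0)) (y := fun x : X => x.1.2) hη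
    hr hP (wm := fun x => (x.2.weight, x.2.mean))
    (fun x => ⟨x.2.weight_nonneg, x.2.weight_sum⟩) (fun x => x.2.weight_mean_opt)
  have hv : ∀ j k, Near (comap f (𝓝 0)) f (fun x => x.2.variance (σ x k) j) (P.stdDev k j ^ 2) :=
    fun j k => near_variance hη hP (w := fun x => x.2.weight) (m := fun x => x.2.mean)
      (fun k => (hσ k).1) (fun k a => (hσ k).2 a)
      (near_aVec hη (M := fun x => sampleM3 x.1.2) (fun t => P.near_sampleM3 t)
        (q := fun x => x.2.q) hq' j)
      (β := fun x i => x.2.variance i j) (fun x => x.2.variance_opt j) k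
  have hO : ∀ k, (fun x : X => l2norm (fun a => P.mean k a - x.2.mean (σ x k) a)
      + |P.weight k - x.2.weight (σ x k)|
      + l2norm (fun t : Fin d × Fin d =>
        P.covariance k t.1 t.2 - x.2.covariance (σ x k) t.1 t.2)) =O[comap f (𝓝 0)] f := by
    intro k
    refine ((isBigO_l2norm_sub (f := fun _ => P.mean k) (fun a => Near.const _)
      (hσ k).2).add ?_).add (isBigO_l2norm_sub (f := fun _ (t : Fin d × Fin d) =>
        P.covariance k t.1 t.2) (fun t => Near.const _) fun t => ?_)
    · have h1 := (Near.const (P.weight k)).sub (hσ k).1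
      rw [Near, sub_self] at h1
      simpa using h1.abs_left
    · simp only [LearningRun.covariance_eq, covariance, Matrix.diagonal_apply]
      split_ifs with ht
      · exact hv t.1 k
      · exact Near.const 0
  -- Adding the nonnegative errors of all components yields one constant valid for each of them.
  have hsum := (IsBigO.fun_sum (s := Finset.univ) fun k _ => hO k).exists_pos
  obtain ⟨C, hC, hb⟩ := hsum
  obtain ⟨δ, hδ, h⟩ := (eventually_comap_nhds_zero (f := f)
    fun x => P.sampleError_nonneg x.1.2).1 hb.bound
  refine ⟨C, hC, δ, hδ, fun N y hy R => ⟨σ ⟨⟨N, y⟩, R⟩, fun i => ?_⟩⟩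
  have h1 := h ⟨⟨N, y⟩, R⟩ hy
  have h2 := (Finset.single_le_sum (f := fun k =>
    l2norm (fun a => P.mean k a - R.mean (σ ⟨⟨N, y⟩, R⟩ k) a)
      + |P.weight k - R.weight (σ ⟨⟨N, y⟩, R⟩ k)|
      + l2norm (fun t : Fin d × Fin d =>
        P.covariance k t.1 t.2 - R.covariance (σ ⟨⟨N, y⟩, R⟩ k) t.1 t.2))
    (fun k _ => add_nonneg (add_nonneg (l2norm_nonneg _) (abs_nonneg _)) (l2norm_nonneg _))
    (Finset.mem_univ i)).trans ((le_abs_self _).trans h1)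
  rw [Real.norm_of_nonneg (P.sampleError_nonneg y)] at h2
  have h3 := l2norm_nonneg (fun a => P.mean i a - R.mean (σ ⟨⟨N, y⟩, R⟩ i) a)
  have h4 := abs_nonneg (P.weight i - R.weight (σ ⟨⟨N, y⟩, R⟩ i))
  have h5 := l2norm_nonneg (fun t : Fin d × Fin d =>
    P.covariance i t.1 t.2 - R.covariance (σ ⟨⟨N, y⟩, R⟩ i) t.1 t.2)
  refine ⟨?_, by linarith, by linarith⟩
  change l2norm (fun a => P.mean i a - R.mean (σ ⟨⟨N, y⟩, R⟩ i) a) ≤ _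
  linarith

end DiagGaussianMixture

end Learning

theorem theorem5p1 {d r : ℕ} [NeZero d] (hr : (r : ℝ) ≤ (d : ℝ) / 2 - 1)
    (P : DiagGaussianMixture d r) (ξ : Tail d r → ℂ)
    (hP : DecompConditions P.decompVec ξ) :
    ∃ C δ : ℝ, 0 < C ∧ 0 < δ ∧
      ∀ (N : ℕ) (_hN : 0 < N) (y : Fin N → Fin d → ℝ) (ε : ℝ),
        ε = max (l2norm (P.M3 - sampleM3 y)) (l2norm (P.M1 - sampleM1 y)) → ε < δ →
          Nonempty (LearningRun r y ξ) ∧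
          ∀ R : LearningRun r y ξ, ∃ π : Equiv.Perm (Fin r), ∀ i,
            l2norm (P.mean i - R.mean (π i)) ≤ C * ε ∧
            |P.weight i - R.weight (π i)| ≤ C * ε ∧
            l2norm (fun t : Fin d × Fin d =>
              P.covariance i t.1 t.2 - R.covariance (π i) t.1 t.2) ≤ C * ε := by
  have hr' : 2 * r + 2 ≤ d := by
    have h : (2 * r + 2 : ℝ) ≤ d := by linarith
    exact_mod_cast h
  obtain ⟨δ₁, hδ₁, hex⟩ := DiagGaussianMixture.exists_learningRun hr' hP
  obtain ⟨C, hC, δ₂, hδ₂, hst⟩ := DiagGaussianMixture.learningRun_stable hr' hP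
  refine ⟨C, min δ₁ δ₂, hC, lt_min hδ₁ hδ₂, fun N _ y ε hε hlt => ?_⟩
  subst hε
  exact ⟨hex N y (hlt.trans_le (min_le_left _ _)), hst N y (hlt.trans_le (min_le_right _ _))⟩
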